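/- Let $\mathcal C\subseteq\mathbb F_2^n$ be a binary linear code whose nonzero codewords have weight at least $2t+1$ and whose permutation automorphism group is transitive on positions (for instance any cyclic code, in particular a $t$-error-correcting BCH code). Let $\sigma>0$. A bit $c$ sent over the bi-AWGN channel is received as $y=(-1)^c+z$, $z\sim\mathcal N(0,\sigma^2)$ (independent uses); its LLR is $l=2y/\sigma^2$, and $\hat l\in\{\pm1\}$ is the sign of $l$. $\mathsf B$ maps a negative value to $1$ and any other value to $0$. **Decoder.** For $\boldsymbol y\in\mathbb F_2^n$, bounded distance decoding (BDD) outputs at position $j$ the value $(-1)^{\tilde c_j}$ if there is $\tilde{\boldsymbol c}\in\mathcal C$ with $\mathsf d_{\mathsf H}(\tilde{\boldsymbol c},\boldsymbol y)\le t$, and $0$ otherwise. In iBDD-CR with extrinsic BDD, the message of a constraint node (CN) on the bit at its position $j$ is $\mathsf B(\tilde\mu+l)$. Here $l$ is the channel LLR of that bit, $\bar\mu$ is the BDD output at $j$ for the incoming messages with the $j$-th one replaced by $\mathsf B(l)$, and $\tilde\mu$ is a correction term depending on $(\bar\mu,\hat l)$ and on the half-iteration only. Initially every message is $\mathsf B(l)$.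 Iteration $\ell\ge1$ consists of row-type CN processing followed by column-type CN processing; each variable node (VN) has degree 2 and forwards the message of its row-type CN to its column-type CN and conversely. **Density evolution.** Consider the decoder on the infinite computation tree of a VN, in which each CN carries $\mathcal C$ (with an arbitrary labelling of the CN positions) and the CN types alternate. A random codeword of the tree, whose root bit $c$ takes both values with positive probability, is sent over the bi-AWGN channel. With $\bar\mu^{\mathsf r,(\ell)}$ the BDD output for the root bit in the row half-iteration $\ell$, the correction terms are, recursively over half-iterations, $$\tilde\mu^{\mathsf r,(\ell)}=\ln\frac{p(\bar\mu^{\mathsf r,(\ell)}\mid\hat l,c=0)}{p(\bar\mu^{\mathsf r,(\ell)}\mid\hat l,c=1)},$$ and $\tilde\mu^{\mathsf c,(\ell)}$ is defined likewise from the column half-iteration. Let $x^{\mathsf r,(\ell)}$, $x^{\mathsf c,(\ell)}$ be the probabilities that the row-type resp. column-type CN message on the root bit in iteration $\ell$ is wrong, and $x^{\mathsf c,(0)}$ the probability that $\mathsf B(l)$ is wrong. **Functions.** Assume the all-zero codeword is sent. For $0\le i\le n-1$ let $P^{\mathsf e}(i),P^{\mathsf c}(i),P^{\epsilon}(i)$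 be the probabilities that BDD outputs $-1$, $+1$, $0$ on a uniformly random position which is initially in error, when $i$ errors are placed uniformly at random in the other $n-1$ positions; let $Q^{\mathsf e}(i),Q^{\mathsf c}(i),Q^{\epsilon}(i)$ be the same when the position is initially correct. For each such family $R\in\{P^{\mathsf e},P^{\mathsf c},P^\epsilon,Q^{\mathsf e},Q^{\mathsf c},Q^\epsilon\}$ put $$f^{R}(x)=\sum_{i=0}^{n-1}\binom{n-1}{i}x^i(1-x)^{n-1-i}R(i).$$ Let $\mathsf Q(x)=\frac1{\sqrt{2\pi}}\int_x^\infty e^{-\xi^2/2}\,d\xi$, and $\bar{\mathbb U}(x)=1$ for $x<0$, $\bar{\mathbb U}(x)=0$ otherwise. **Proposition.** 1. For all $\ell\ge1$, with $x=x^{\mathsf c,(\ell-1)}$ for $\tilde\mu^{\mathsf r,(\ell)}$ and $x=x^{\mathsf r,(\ell)}$ for $\tilde\mu^{\mathsf c,(\ell)}$, the correction term is given by: $(\bar\mu,\hat l)=(-1,-1)$: $\ln\frac{f^{P^{\mathsf e}}(x)}{f^{Q^{\mathsf c}}(x)}$; $(1,-1)$: $\ln\frac{f^{P^{\mathsf c}}(x)}{f^{Q^{\mathsf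 e}}(x)}$; $(0,-1)$: $\ln\frac{f^{P^\epsilon}(x)}{f^{Q^\epsilon}(x)}$; $(-1,1)$: $\ln\frac{f^{Q^{\mathsf e}}(x)}{f^{P^{\mathsf c}}(x)}$; $(1,1)$: $\ln\frac{f^{Q^{\mathsf c}}(x)}{f^{P^{\mathsf e}}(x)}$; $(0,1)$: $\ln\frac{f^{Q^\epsilon}(x)}{f^{P^\epsilon}(x)}$. (If numerator and denominator both vanish, the pair does not occur, and both sides are read as $0$.) 2. With the same $x$, $p(\bar\mu\mid\hat l=-1,c=0)$ equals $f^{P^{\mathsf e}}(x),f^{P^{\mathsf c}}(x),f^{P^\epsilon}(x)$ for $\bar\mu=-1,1,0$; $p(\bar\mu\mid\hat l=1,c=0)$ equals $f^{Q^{\mathsf e}}(x),f^{Q^{\mathsf c}}(x),f^{Q^\epsilon}(x)$ for $\bar\mu=-1,1,0$; and $p(\bar\mu\mid\hat l,c=1)=p(-\bar\mu\mid-\hat l,c=0)$. Moreover $P^\epsilon(i)=1-P^{\mathsf e}(i)-P^{\mathsf c}(i)$ and $Q^\epsilon(i)=1-Q^{\mathsf e}(i)-Q^{\mathsf c}(i)$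 for $0\le i\le n-1$. 3. $x^{\mathsf c,(0)}=\mathsf Q(1/\sigma)$, and for all $\ell\ge1$, $x^{\mathsf r,(\ell)}=\mathsf f(x^{\mathsf c,(\ell-1)})$ and $x^{\mathsf c,(\ell)}=\mathsf f(x^{\mathsf r,(\ell)})$, where $$\mathsf f(x)=\sum_{(A,B)}f^{A}(x)\,\mathsf Q\Big(\tfrac\sigma2\max\big(\ln\tfrac{f^{A}(x)}{f^{B}(x)},0\big)+\tfrac1\sigma\Big)+\sum_{(A,B)}f^{B}(x)\Big(\mathsf Q\Big(\tfrac\sigma2\ln\tfrac{f^{B}(x)}{f^{A}(x)}+\tfrac1\sigma\Big)-\mathsf Q\big(\tfrac1\sigma\big)\Big)\bar{\mathbb U}\Big(\ln\tfrac{f^{B}(x)}{f^{A}(x)}\Big),$$ both sums being over $(A,B)\in\{(P^{\mathsf e},Q^{\mathsf c}),(P^{\mathsf c},Q^{\mathsf e}),(P^\epsilon,Q^\epsilon)\}$ (with the same convention for $0/0$). 4. Consider the regular GLDPC ensemble with $M$ row-type and $M$ column-type CNs of degree $n$ carrying $\mathcal C$, and $nM$ VNs of degree 2, each joined to one CN of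 each type by a uniformly random edge permutation (for $M=n$, one permutation gives the product code of $\mathcal C$). Transmit, for each permutation, any codeword of the resulting code, and decode by iBDD-CR with the correction terms of part 1. Then for every $\ell\ge1$ the message error probabilities after the row and the column half-iteration $\ell$, averaged over the permutation, the VNs and the noise, converge to $x^{\mathsf r,(\ell)}$ and $x^{\mathsf c,(\ell)}$ as $M\to\infty$. -/

import Mathlib

open MeasureTheory ProbabilityTheory Filter Topology

namespace IBDDCR

noncomputable section

/-! ## Notation -/

/-- Tail probability of the standard Gaussian distribution. -/
def gaussQ (x : ℝ) : ℝ :=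
  1 / Real.sqrt (2 * Real.pi) * ∫ ξ in Set.Ioi x, Real.exp (-ξ ^ 2 / 2)

/-- The indicator of the negative half-line. -/
def ubar (x : ℝ) : ℝ := if x < 0 then 1 else 0

/-- The antipodal map `0 ↦ +1`, `1 ↦ -1` from bits to real channel inputs. -/
def bpsk (b : ZMod 2) : ℝ := if b = 0 then 1 else -1

/-- The sign of a soft value, in `{±1}` (an exact tie counts as `+1`). -/
def hardSign (l : ℝ) : SignType := if l < 0 then -1 else 1

/-- The hard decision on a soft value: `-1 ↦ 1`, `+1 ↦ 0`. -/
def hardBit (l : ℝ) : ZMod 2 := if l < 0 then 1 else 0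

/-- The channel LLR `(2 / σ²) y` of the bi-AWGN output `y = (-1)^b + z` for bit `b` and noise `z`. -/
def llr (σ : ℝ) (b : ZMod 2) (z : ℝ) : ℝ := 2 / σ ^ 2 * (bpsk b + z)

/-- A combining look-up table at one half-iteration: a real number for each BDD output
in `{-1, 0, 1}` (first argument) and each channel hard decision in `{±1}` (second argument). -/
abbrev Lut := SignType → SignType → ℝ

/-! ## Component code and bounded distance decoding -/

variable {n : ℕ}

/-- Binary linear codes of length `n`. -/
abbrev LinCode (n : ℕ) := Submodule (ZMod 2) (Fin n → ZMod 2)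

/-- Every nonzero codeword has weight at least `2 t + 1`, i.e. `t ≤ ⌊(d_min - 1) / 2⌋`. -/
def CorrectsErrors (C : LinCode n) (t : ℕ) : Prop :=
  ∀ c ∈ C, c ≠ 0 → 2 * t + 1 ≤ hammingNorm c

/-- The permutation automorphism group of the code is transitive on positions. This holds for
every cyclic code, in particular for BCH codes. -/
def HasTransitiveAut (C : LinCode n) : Prop :=
  ∀ i j : Fin n, ∃ τ : Equiv.Perm (Fin n), τ i = j ∧ ∀ c ∈ C, (fun k => c (τ k)) ∈ C

open Classical in
/-- Output on position `j` of the bounded distance decoder of radius `t` with input `y`: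
`(-1)^(c j)` if some codeword `c` lies within Hamming distance `t` of `y` (the transmitted one, or
another one in the case of a miscorrection), and `0` if there is none. The codeword is unique when
`CorrectsErrors C t`. -/
def bdd (C : LinCode n) (t : ℕ) (y : Fin n → ZMod 2) (j : Fin n) : SignType :=
  if ∃ c ∈ C, hammingDist c y ≤ t ∧ c j = 0 then 1
  else if ∃ c ∈ C, hammingDist c y ≤ t ∧ c j = 1 then -1
  else 0

/-- Extrinsic BDD of position `j`: the `j`-th input is replaced by the channel hard decision `r`. -/
def extBdd (C : LinCode n) (t : ℕ) (y : Fin n → ZMod 2) (j : Fin n) (r : ZMod 2) : SignType :=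
  bdd C t (Function.update y j r) j

/-- The message sent by a constraint node on position `j`: the correction term `μ̃`, looked up from
the BDD output and the sign of the channel LLR `l`, is added to `l`, and the sum is hard-decided. -/
def cnMsg (C : LinCode n) (t : ℕ) (μ : Lut) (y : Fin n → ZMod 2) (j : Fin n) (l : ℝ) : ZMod 2 :=
  hardBit (μ (extBdd C t y j (hardBit l)) (hardSign l) + l)

/-! ## Outcome probabilities of BDD for a given number of errors -/

/-- The word with value `a` at position `j`, ones on `S`, and zeros elsewhere. -/
def errWord (a : ZMod 2) (j : Fin n) (S : Finset (Fin n)) : Fin n → ZMod 2 :=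
  fun k => if k = j then a else if k ∈ S then 1 else 0

open Classical in
/-- The all-zero codeword being transmitted: probability that BDD outputs `u` on a uniformly random
position, when that position is initially in error (`a = 1`) or correct (`a = 0`) and `i` errors are
placed uniformly at random in the other `n - 1` positions. -/
def outcomeProb (C : LinCode n) (t : ℕ) (a : ZMod 2) (u : SignType) (i : ℕ) : ℝ :=
  (∑ j : Fin n, (((Finset.univ.erase j).powersetCard i).filter
      (fun S => bdd C t (errWord a j S) j = u)).card : ℝ) / ((n : ℝ) * ((n - 1).choose i : ℝ))

/-- Initially in error, decoded incorrectly. -/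
def Pe (C : LinCode n) (t i : ℕ) : ℝ := outcomeProb C t 1 (-1) i
/-- Initially in error, decoded correctly. -/
def Pc (C : LinCode n) (t i : ℕ) : ℝ := outcomeProb C t 1 1 i
/-- Initially in error, erased. -/
def Pz (C : LinCode n) (t i : ℕ) : ℝ := outcomeProb C t 1 0 i
/-- Initially correct, decoded incorrectly. -/
def Qe (C : LinCode n) (t i : ℕ) : ℝ := outcomeProb C t 0 (-1) i
/-- Initially correct, decoded correctly. -/
def Qc (C : LinCode n) (t i : ℕ) : ℝ := outcomeProb C t 0 1 i
/-- Initially correct, erased. -/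
def Qz (C : LinCode n) (t i : ℕ) : ℝ := outcomeProb C t 0 0 i

/-- Binomial mixture over the number of errors in the other `n - 1` positions. -/
def mix (n : ℕ) (p : ℕ → ℝ) (x : ℝ) : ℝ :=
  ∑ i ∈ Finset.range n, ((n - 1).choose i : ℝ) * x ^ i * (1 - x) ^ (n - 1 - i) * p i

def fPe (C : LinCode n) (t : ℕ) (x : ℝ) : ℝ := mix n (Pe C t) x
def fPc (C : LinCode n) (t : ℕ) (x : ℝ) : ℝ := mix n (Pc C t) x
def fPz (C : LinCode n) (t : ℕ) (x : ℝ) : ℝ := mix n (Pz C t) x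
def fQe (C : LinCode n) (t : ℕ) (x : ℝ) : ℝ := mix n (Qe C t) x
def fQc (C : LinCode n) (t : ℕ) (x : ℝ) : ℝ := mix n (Qc C t) x
def fQz (C : LinCode n) (t : ℕ) (x : ℝ) : ℝ := mix n (Qz C t) x

/-- The closed-form density evolution step at noise standard deviation `σ` and input message error
probability `x`. -/
def deStep (C : LinCode n) (t : ℕ) (σ x : ℝ) : ℝ :=
  fPe C t x * gaussQ (σ / 2 * max (Real.log (fPe C t x / fQc C t x)) 0 + 1 / σ)
  + fPc C t x * gaussQ (σ / 2 * max (Real.log (fPc C t x / fQe C t x)) 0 + 1 / σ)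
  + fPz C t x * gaussQ (σ / 2 * max (Real.log (fPz C t x / fQz C t x)) 0 + 1 / σ)
  + fQe C t x * (gaussQ (σ / 2 * Real.log (fQe C t x / fPc C t x) + 1 / σ) - gaussQ (1 / σ))
      * ubar (Real.log (fQe C t x / fPc C t x))
  + fQc C t x * (gaussQ (σ / 2 * Real.log (fQc C t x / fPe C t x) + 1 / σ) - gaussQ (1 / σ))
      * ubar (Real.log (fQc C t x / fPe C t x))
  + fQz C t x * (gaussQ (σ / 2 * Real.log (fQz C t x / fPz C t x) + 1 / σ) - gaussQ (1 / σ))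
      * ubar (Real.log (fQz C t x / fPz C t x))

/-! ## The computation tree of density evolution

A variable node is addressed by the list of positions that leads to it, the root being `[]`. The
constraint node below the variable node `v` has `v` at position `pos v`, and for `i ≠ pos v` its
position `i` is taken by the variable node `i :: v`. (Addresses with an entry `i = pos v` do not
occur in the tree and never influence a message of a variable node that does.) The labelling `pos`
is arbitrary. The constraint nodes alternate between row type and column type with the depth, and
the root message of half-iteration `h` is computed from messages of half-iteration `h - 1`. Row
processing in iteration `ℓ ≥ 1` is half-iteration `2 ℓ - 1`, column processing is `2 ℓ`. -/

/-- An assignment of bits to the variable nodes of the tree that satisfies all constraint nodes. -/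
def IsTreeCodeword (C : LinCode n) (pos : List (Fin n) → Fin n) (c : List (Fin n) → ZMod 2) :
    Prop :=
  ∀ v, (fun i => if i = pos v then c v else c (i :: v)) ∈ C

/-- The message on variable node `v` after `h` half-iterations of extrinsic iBDD-CR with correction
tables `μ 1, μ 2, …`, given the channel LLRs `l`. -/
def treeMsg (C : LinCode n) (t : ℕ) (pos : List (Fin n) → Fin n) (μ : ℕ → Lut)
    (l : List (Fin n) → ℝ) : ℕ → List (Fin n) → ZMod 2
  | 0, v => hardBit (l v)
  | h + 1, v => cnMsg C t (μ (h + 1)) (fun i => treeMsg C t pos μ l h (i :: v)) (pos v) (l v)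

/-- The BDD output on the root in half-iteration `h + 1`. It depends on `μ 1, …, μ h` only. -/
def treeBdd (C : LinCode n) (t : ℕ) (pos : List (Fin n) → Fin n) (μ : ℕ → Lut)
    (l : List (Fin n) → ℝ) (h : ℕ) : SignType :=
  extBdd C t (fun i => treeMsg C t pos μ l h [i]) (pos []) (hardBit (l []))

section Tree

variable {Ω : Type*} [MeasurableSpace Ω]

/-- Channel LLRs of the random tree codeword `c` under the noise `z`. -/
def treeLlr (σ : ℝ) (c : Ω → List (Fin n) → ZMod 2) (z : Ω → List (Fin n) → ℝ) (ω : Ω) :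
    List (Fin n) → ℝ :=
  fun v => llr σ (c ω v) (z ω v)

/-- Conditional probability that the root BDD output of half-iteration `h + 1` is `u`, given that the
sign of the root channel LLR is `s` and the root bit is `b`. -/
def condBdd (P : Measure Ω) (C : LinCode n) (t : ℕ) (σ : ℝ) (pos : List (Fin n) → Fin n)
    (c : Ω → List (Fin n) → ZMod 2) (z : Ω → List (Fin n) → ℝ) (μ : ℕ → Lut) (h : ℕ)
    (u s : SignType) (b : ZMod 2) : ℝ :=
  (cond P {ω | hardSign (treeLlr σ c z ω []) = s ∧ c ω [] = b}).real
    {ω | treeBdd C t pos μ (treeLlr σ c z ω) h = u}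

/-- Auxiliary recursion for `muTilde`: the tables of the half-iterations `1, …, h` (the others are
still `0`). -/
def muUpTo (P : Measure Ω) (C : LinCode n) (t : ℕ) (σ : ℝ) (pos : List (Fin n) → Fin n)
    (c : Ω → List (Fin n) → ZMod 2) (z : Ω → List (Fin n) → ℝ) : ℕ → ℕ → Lut
  | 0 => fun _ _ _ => 0
  | h + 1 => Function.update (muUpTo P C t σ pos c z h) (h + 1) (fun u s =>
      Real.log (condBdd P C t σ pos c z (muUpTo P C t σ pos c z h) h u s 0
        / condBdd P C t σ pos c z (muUpTo P C t σ pos c z h) h u s 1))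

/-- The LLR correction terms `μ̃` of half-iteration `h ≥ 1`: the log-ratio of the conditional
probabilities of the BDD output of half-iteration `h`, given the channel hard decision and the
transmitted bit being `0` resp. `1`, when all earlier half-iterations used their own correction
terms. -/
def muTilde (P : Measure Ω) (C : LinCode n) (t : ℕ) (σ : ℝ) (pos : List (Fin n) → Fin n)
    (c : Ω → List (Fin n) → ZMod 2) (z : Ω → List (Fin n) → ℝ) (h : ℕ) : Lut :=
  muUpTo P C t σ pos c z h h

/-- The message error probability after `h` half-iterations of iBDD-CR. -/
def msgErr (P : Measure Ω) (C : LinCode n) (t : ℕ) (σ : ℝ) (pos : List (Fin n) → Fin n)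
    (c : Ω → List (Fin n) → ZMod 2) (z : Ω → List (Fin n) → ℝ) (h : ℕ) : ℝ :=
  P.real {ω | treeMsg C t pos (muTilde P C t σ pos c z) (treeLlr σ c z ω) h [] ≠ c ω []}

/-- Message error probability at the output of the row-type constraint nodes in iteration `ℓ ≥ 1`. -/
def rowErr (P : Measure Ω) (C : LinCode n) (t : ℕ) (σ : ℝ) (pos : List (Fin n) → Fin n)
    (c : Ω → List (Fin n) → ZMod 2) (z : Ω → List (Fin n) → ℝ) (ℓ : ℕ) : ℝ :=
  msgErr P C t σ pos c z (2 * ℓ - 1)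

/-- Message error probability at the output of the column-type constraint nodes in iteration `ℓ`;
for `ℓ = 0`, of the channel hard decisions. -/
def colErr (P : Measure Ω) (C : LinCode n) (t : ℕ) (σ : ℝ) (pos : List (Fin n) → Fin n)
    (c : Ω → List (Fin n) → ZMod 2) (z : Ω → List (Fin n) → ℝ) (ℓ : ℕ) : ℝ :=
  msgErr P C t σ pos c z (2 * ℓ)

end Tree

/-! ## The regular GLDPC ensemble

`M` row-type and `M` column-type constraint nodes with `n` sockets each, and `n M` variable nodes of
degree 2. A variable node is identified with its row socket, and the edge permutation `π` maps it to
its column socket. -/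

/-- The member of the ensemble given by the edge permutation `π`. -/
def gldpcCode {M : ℕ} (C : LinCode n) (π : Equiv.Perm (Fin M × Fin n)) :
    Set (Fin M × Fin n → ZMod 2) :=
  {c | (∀ a, (fun i => c (a, i)) ∈ C) ∧ ∀ b, (fun i => c (π.symm (b, i))) ∈ C}

/-- Product codes (arrays all of whose rows and columns are component codewords) are members. -/
theorem productCode_mem_ensemble (C : LinCode n) :
    gldpcCode C (Equiv.prodComm (Fin n) (Fin n)) =
      {c | (∀ a, (fun i => c (a, i)) ∈ C) ∧ ∀ b, (fun i => c (i, b)) ∈ C} := rfl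

/-- The message on a variable node after `h` half-iterations of extrinsic iBDD-CR on the graph of
`π`; the odd half-iterations process rows, the even ones columns. -/
def ensMsg {M : ℕ} (C : LinCode n) (t : ℕ) (π : Equiv.Perm (Fin M × Fin n)) (μ : ℕ → Lut)
    (l : Fin M × Fin n → ℝ) : ℕ → Fin M × Fin n → ZMod 2
  | 0, e => hardBit (l e)
  | h + 1, e =>
    if Even h then
      cnMsg C t (μ (h + 1)) (fun i => ensMsg C t π μ l h (e.1, i)) e.2 (l e)
    else
      cnMsg C t (μ (h + 1)) (fun i => ensMsg C t π μ l h (π.symm ((π e).1, i))) (π e).2 (l e)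

/-- The message error probability after `h` half-iterations, averaged over the ensemble with `M`
row and `M` column constraint nodes (uniformly random edge permutation), over a uniformly random
variable node, and over the noise, if `c π` is transmitted over the graph of `π`. -/
def ensErr (C : LinCode n) (t : ℕ) (σ : ℝ) (μ : ℕ → Lut) (M : ℕ)
    (c : Equiv.Perm (Fin M × Fin n) → Fin M × Fin n → ZMod 2) (h : ℕ) : ℝ :=
  (∑ π : Equiv.Perm (Fin M × Fin n), ∑ e : Fin M × Fin n,
    (Measure.pi (fun _ : Fin M × Fin n => gaussianReal 0 (σ ^ 2).toNNReal)).real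
      {z | ensMsg C t π μ (fun e' => llr σ (c π e') (z e')) h e ≠ c π e})
    / (Fintype.card (Equiv.Perm (Fin M × Fin n)) * Fintype.card (Fin M × Fin n))

end

end IBDDCR

open IBDDCR

/-!
The channel and the linear codes are invariant under translation by a codeword, and correction
tables that are log-ratios are odd under the antipodal map, so the error pattern of the messages
does not depend on the transmitted word. When the neighbourhood of a variable node is a tree, the
messages entering a constraint node are independent; the number of errors among them is then
binomial, and since the automorphism group of the code is transitive, the outcome probabilities of
bounded distance decoding do not depend on the position. This gives the polynomials `f^R` for the
correction terms, and Gaussian tails give `deStep`. On the ensemble, switching the sockets of two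
variable nodes shows that the first collision in a neighbourhood of bounded depth is unlikely, so
the messages have the error probability of the tree with probability tending to one.
-/

namespace IBDDCR

noncomputable section

variable {n : ℕ}

/-! ### Symmetries of bounded distance decoding -/

/-- The hard decision `(-1) ^ a` of a bit `a`: the discrete counterpart of `bpsk`, in the alphabet
of the outputs of the bounded distance decoder. -/
def bitSign (a : ZMod 2) : SignType := if a = 0 then 1 else -1

theorem eq_zero_or_eq_one (a : ZMod 2) : a = 0 ∨ a = 1 := by
  revert a; decide

theorem ne_iff_eq_add_one (a b : ZMod 2) : a ≠ b ↔ a = b + 1 := by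
  revert a b; decide

theorem add_eq_one_iff_eq_add_one (a b : ZMod 2) : a + b = 1 ↔ a = b + 1 := by
  revert a b; decide

theorem bitSign_injective : Function.Injective bitSign := by
  unfold Function.Injective; decide

theorem bitSign_add_eq_iff (a b : ZMod 2) (u : SignType) :
    u = bitSign (a + b) ↔ bitSign b * u = bitSign a := by
  revert a b u; decide

theorem eq_of_forall_eq_bitSign_iff {u v : SignType}
    (h : ∀ a, u = bitSign a ↔ v = bitSign a) : u = v := by
  revert u v; decide

theorem sum_signType {M : Type*} [AddCommMonoid M] (f : SignType → M) :
    ∑ u, f u = f 0 + f (-1) + f 1 := by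
  rw [show (Finset.univ : Finset SignType) = {0, -1, 1} from rfl, Finset.sum_insert (by decide),
    Finset.sum_pair (by decide), add_assoc]

theorem hardSign_eq_bitSign (l : ℝ) : hardSign l = bitSign (hardBit l) := by
  unfold hardSign hardBit; split_ifs <;> rfl

/-- Some codeword within Hamming distance `t` of `y` has the bit `a` at position `j`, so that
bounded distance decoding of `y` may return `a` there. -/
def Decodes (C : LinCode n) (t : ℕ) (y : Fin n → ZMod 2) (j : Fin n) (a : ZMod 2) : Prop :=
  ∃ c ∈ C, hammingDist c y ≤ t ∧ c j = a

theorem Decodes.unique {C : LinCode n} {t : ℕ} (hC : CorrectsErrors C t) {y : Fin n → ZMod 2}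
    {j : Fin n} {a b : ZMod 2} (ha : Decodes C t y j a) (hb : Decodes C t y j b) : a = b := by
  obtain ⟨c, hc, hcy, rfl⟩ := ha
  obtain ⟨d, hd, hdy, rfl⟩ := hb
  by_contra hne
  have hweight := hC (-c + d) (C.add_mem (C.neg_mem hc) hd)
    fun h => hne (by rw [neg_add_eq_zero.1 h])
  have htriangle := hammingDist_triangle_right c d y
  rw [hammingDist_eq_hammingNorm] at htriangle
  omega

open Classical in
theorem bdd_eq_ite (C : LinCode n) (t : ℕ) (y : Fin n → ZMod 2) (j : Fin n) :
    bdd C t y j = if Decodes C t y j 0 then 1 else if Decodes C t y j 1 then -1 else 0 := by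
  unfold bdd Decodes
  congr

theorem bdd_eq_of_forall_decodes_iff {C : LinCode n} {t : ℕ} {y z : Fin n → ZMod 2} {j k : Fin n}
    (h : ∀ a, Decodes C t y j a ↔ Decodes C t z k a) : bdd C t y j = bdd C t z k := by
  classical
  rw [bdd_eq_ite, bdd_eq_ite]
  exact if_congr (h 0) rfl (if_congr (h 1) rfl rfl)

theorem bdd_eq_bitSign_iff {C : LinCode n} {t : ℕ} (hC : CorrectsErrors C t) (y : Fin n → ZMod 2)
    (j : Fin n) (a : ZMod 2) : bdd C t y j = bitSign a ↔ Decodes C t y j a := by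
  have hunique : ¬ (Decodes C t y j 0 ∧ Decodes C t y j 1) := fun h =>
    zero_ne_one (h.1.unique hC h.2)
  rw [bdd_eq_ite]
  rcases eq_zero_or_eq_one a with rfl | rfl <;> split_ifs <;> simp_all [bitSign]

theorem Decodes.add {C : LinCode n} {t : ℕ} {w y : Fin n → ZMod 2} {j : Fin n} {a : ZMod 2}
    (hw : w ∈ C) : Decodes C t y j a → Decodes C t (y + w) j (a + w j) := by
  rintro ⟨c, hc, hcy, rfl⟩
  refine ⟨c + w, C.add_mem hc hw, ?_, rfl⟩
  rwa [hammingDist_eq_hammingNorm, show -(c + w) + (y + w) = -c + y by abel,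
    ← hammingDist_eq_hammingNorm]

theorem decodes_add_iff {C : LinCode n} {t : ℕ} {w y : Fin n → ZMod 2} {j : Fin n} {a : ZMod 2}
    (hw : w ∈ C) : Decodes C t (y + w) j a ↔ Decodes C t y j (a + w j) := by
  constructor <;> intro h <;> simpa [add_assoc, ZModModule.add_self] using h.add hw

theorem bdd_add {C : LinCode n} {t : ℕ} (hC : CorrectsErrors C t) {w : Fin n → ZMod 2}
    (hw : w ∈ C) (y : Fin n → ZMod 2) (j : Fin n) :
    bdd C t (y + w) j = bitSign (w j) * bdd C t y j := by
  refine eq_of_forall_eq_bitSign_iff fun a => ?_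
  rw [bdd_eq_bitSign_iff hC, decodes_add_iff hw, ← bdd_eq_bitSign_iff hC, bitSign_add_eq_iff]

theorem extBdd_add {C : LinCode n} {t : ℕ} (hC : CorrectsErrors C t) {w : Fin n → ZMod 2}
    (hw : w ∈ C) (y : Fin n → ZMod 2) (j : Fin n) (r : ZMod 2) :
    extBdd C t (y + w) j (r + w j) = bitSign (w j) * extBdd C t y j r := by
  have hupdate : Function.update (y + w) j (r + w j) = Function.update y j r + w := by
    rw [Function.update_add, Function.update_eq_self]
  rw [extBdd, hupdate, bdd_add hC hw, extBdd]

theorem extBdd_eq_bdd_errWord (C : LinCode n) (t : ℕ) (y : Fin n → ZMod 2) (j : Fin n)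
    (r : ZMod 2) :
    extBdd C t y j r = bdd C t (errWord r j ({i | i ≠ j ∧ y i = 1} : Finset (Fin n))) j := by
  unfold extBdd
  congr 1
  ext i
  by_cases hij : i = j
  · simp [errWord, hij]
  · rcases eq_zero_or_eq_one (y i) with hi | hi <;> simp [errWord, hij, hi]

theorem dependsOn_extBdd (C : LinCode n) (t : ℕ) (j : Fin n) (r : ZMod 2) :
    DependsOn (fun y => extBdd C t y j r) {j}ᶜ := fun x y hxy => by
  simp only [extBdd]
  congr 1
  ext i
  by_cases hij : i = j
  · simp [hij]
  · simp [hij, hxy i hij]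

theorem hammingDist_comp_equiv {ι κ β : Type*} [Fintype ι] [Fintype κ] [DecidableEq β] (e : ι ≃ κ)
    (x y : κ → β) : hammingDist (x ∘ e) (y ∘ e) = hammingDist x y :=
  Finset.card_equiv e (by simp)

theorem decodes_comp_perm_iff {C : LinCode n} {t : ℕ} {τ : Equiv.Perm (Fin n)}
    (hτ : ∀ c ∈ C, c ∘ τ ∈ C) (y : Fin n → ZMod 2) (j : Fin n) (a : ZMod 2) :
    Decodes C t (y ∘ τ) j a ↔ Decodes C t y (τ j) a := by
  have hbij : Set.BijOn (fun c : Fin n → ZMod 2 => c ∘ τ) C C :=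
    ((Set.toFinite _).injOn_iff_bijOn_of_mapsTo hτ).1 (τ.surjective.injective_comp_right.injOn)
  constructor
  · rintro ⟨c, hc, hcy, hcj⟩
    obtain ⟨d, hd, rfl⟩ := hbij.surjOn hc
    exact ⟨d, hd, hammingDist_comp_equiv τ d y ▸ hcy, hcj⟩
  · rintro ⟨c, hc, hcy, hcj⟩
    exact ⟨c ∘ τ, hτ c hc, (hammingDist_comp_equiv τ c y).symm ▸ hcy, hcj⟩

theorem bdd_comp_perm {C : LinCode n} (t : ℕ) {τ : Equiv.Perm (Fin n)}
    (hτ : ∀ c ∈ C, c ∘ τ ∈ C) (y : Fin n → ZMod 2) (j : Fin n) :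
    bdd C t (y ∘ τ) j = bdd C t y (τ j) :=
  bdd_eq_of_forall_decodes_iff (decodes_comp_perm_iff hτ y j)

/-! ### Outcome probabilities -/

open Classical in
/-- The sets of `i` error positions other than `j` for which bounded distance decoding outputs `u`
on position `j`, that position carrying the error bit `a`. Their proportion among all `i`-sets,
averaged over `j`, is `outcomeProb`. -/
def outcomeSets (C : LinCode n) (t : ℕ) (a : ZMod 2) (u : SignType) (i : ℕ) (j : Fin n) :
    Finset (Finset (Fin n)) :=
  ((Finset.univ.erase j).powersetCard i).filter fun S => bdd C t (errWord a j S) j = u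

theorem mem_outcomeSets {C : LinCode n} {t : ℕ} {a : ZMod 2} {u : SignType} {i : ℕ} {j : Fin n}
    {S : Finset (Fin n)} :
    S ∈ outcomeSets C t a u i j ↔ (j ∉ S ∧ S.card = i) ∧ bdd C t (errWord a j S) j = u := by
  simp [outcomeSets, Finset.mem_powersetCard, Finset.subset_erase]

theorem outcomeProb_eq_sum_card (C : LinCode n) (t : ℕ) (a : ZMod 2) (u : SignType) (i : ℕ) :
    outcomeProb C t a u i =
      (∑ j, ((outcomeSets C t a u i j).card : ℝ)) / (n * (n - 1).choose i) := rfl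

theorem sum_card_outcomeSets (C : LinCode n) (t : ℕ) (a : ZMod 2) (i : ℕ) (j : Fin n) :
    ∑ u, (outcomeSets C t a u i j).card = (n - 1).choose i := by
  classical
  have hcard : ((Finset.univ.erase j).powersetCard i).card = (n - 1).choose i := by simp
  rw [← hcard]
  exact (Finset.card_eq_sum_card_fiberwise (f := fun S => bdd C t (errWord a j S) j)
    fun _ _ => Finset.mem_coe.2 (Finset.mem_univ _)).symm

theorem sum_outcomeProb (C : LinCode n) (t : ℕ) (a : ZMod 2) {i : ℕ} (hi : i < n) :
    ∑ u, outcomeProb C t a u i = 1 := by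
  have hn : (n : ℝ) ≠ 0 := by exact_mod_cast (Nat.zero_le i).trans_lt hi |>.ne'
  have hchoose : ((n - 1).choose i : ℝ) ≠ 0 := by
    exact_mod_cast (Nat.choose_pos (Nat.le_sub_one_of_lt hi)).ne'
  simp only [outcomeProb_eq_sum_card]
  rw [← Finset.sum_div, Finset.sum_comm]
  simp_rw [← Nat.cast_sum, sum_card_outcomeSets]
  rw [Finset.sum_const, Finset.card_univ, Fintype.card_fin, smul_eq_mul, Nat.cast_mul,
    div_self (mul_ne_zero hn hchoose)]

theorem outcomeProb_zero (C : LinCode n) (t : ℕ) (a : ZMod 2) {i : ℕ} (hi : i < n) :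
    outcomeProb C t a 0 i = 1 - outcomeProb C t a (-1) i - outcomeProb C t a 1 i := by
  have hsum := sum_outcomeProb C t a hi
  rw [sum_signType] at hsum
  linarith

theorem errWord_eq_comp_perm (a : ZMod 2) (j : Fin n) (τ : Equiv.Perm (Fin n))
    (S : Finset (Fin n)) :
    errWord a j S = errWord a (τ j) (S.map τ.toEmbedding) ∘ τ := by
  ext k
  simp [errWord]

theorem card_outcomeSets_eq {C : LinCode n} (hCt : HasTransitiveAut C) (t : ℕ) (a : ZMod 2)
    (u : SignType) (i : ℕ) (j k : Fin n) :
    (outcomeSets C t a u i j).card = (outcomeSets C t a u i k).card := by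
  obtain ⟨τ, rfl, hτ⟩ := hCt j k
  refine Finset.card_equiv τ.finsetCongr fun S => ?_
  simp [mem_outcomeSets, errWord_eq_comp_perm a j τ S, bdd_comp_perm t hτ]

theorem outcomeProb_eq_card_div {C : LinCode n} (hCt : HasTransitiveAut C) (t : ℕ) (a : ZMod 2)
    (u : SignType) (i : ℕ) (j : Fin n) :
    outcomeProb C t a u i = (outcomeSets C t a u i j).card / (n - 1).choose i := by
  have hn : (n : ℝ) ≠ 0 := by exact_mod_cast j.pos.ne'
  rw [outcomeProb_eq_sum_card, Finset.sum_congr rfl fun k _ => by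
    rw [card_outcomeSets_eq hCt t a u i k j], Finset.sum_const, Finset.card_univ, Fintype.card_fin,
    nsmul_eq_mul, mul_div_mul_left _ _ hn]

open Classical in
theorem mix_outcomeProb {C : LinCode n} (hCt : HasTransitiveAut C) (t : ℕ) (a : ZMod 2)
    (u : SignType) (j : Fin n) (x : ℝ) :
    mix n (outcomeProb C t a u) x = ∑ S ∈ (Finset.univ.erase j).powerset with
      bdd C t (errWord a j S) j = u, x ^ S.card * (1 - x) ^ (n - 1 - S.card) := by
  have hcard : (Finset.univ.erase j).card + 1 = n := by
    rw [Finset.card_erase_add_one (Finset.mem_univ j), Finset.card_univ, Fintype.card_fin]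
  rw [Finset.sum_filter, Finset.sum_powerset, hcard, mix]
  refine Finset.sum_congr rfl fun i hi => ?_
  have hchoose : ((n - 1).choose i : ℝ) ≠ 0 := by
    exact_mod_cast (Nat.choose_pos (Nat.le_sub_one_of_lt (Finset.mem_range.1 hi))).ne'
  have hterm : ∀ S ∈ outcomeSets C t a u i j,
      x ^ S.card * (1 - x) ^ (n - 1 - S.card) = x ^ i * (1 - x) ^ (n - 1 - i) := fun S hS => by
    rw [(mem_outcomeSets.1 hS).1.2]
  rw [← Finset.sum_filter, ← outcomeSets, Finset.sum_congr rfl hterm, Finset.sum_const,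
    nsmul_eq_mul, outcomeProb_eq_card_div hCt t a u i j]
  field_simp

/-! ### The Gaussian channel -/

/-- The law of the channel noise. -/
abbrev noiseLaw (σ : ℝ) : Measure ℝ := gaussianReal 0 (σ ^ 2).toNNReal

theorem gaussianReal_real_Ioi (x : ℝ) : (gaussianReal 0 1).real (Set.Ioi x) = gaussQ x := by
  rw [measureReal_def, gaussianReal_apply_eq_integral 0 one_ne_zero, ENNReal.toReal_ofReal
    (integral_nonneg fun y => gaussianPDFReal_nonneg _ _ _), gaussQ, ← integral_const_mul]
  simp [gaussianPDFReal]

theorem noiseLaw_eq_map_mul (σ : ℝ) : noiseLaw σ = (gaussianReal 0 1).map (σ * ·) := by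
  rw [gaussianReal_map_const_mul, mul_zero, mul_one, noiseLaw,
    Real.toNNReal_of_nonneg (sq_nonneg σ)]

theorem noiseLaw_map_neg (σ : ℝ) : (noiseLaw σ).map (fun z => -z) = noiseLaw σ := by
  rw [gaussianReal_map_neg, neg_zero]

theorem noiseLaw_real_Iio_neg {σ : ℝ} (hσ : 0 < σ) (y : ℝ) :
    (noiseLaw σ).real (Set.Iio (-y)) = gaussQ (y / σ) := by
  rw [← noiseLaw_map_neg, map_measureReal_apply measurable_neg measurableSet_Iio,
    noiseLaw_eq_map_mul, map_measureReal_apply (by fun_prop) (measurable_neg measurableSet_Iio),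
    ← gaussianReal_real_Ioi]
  congr 1
  ext z
  simp [div_lt_iff₀' hσ]

theorem add_llr_zero_neg_iff {σ : ℝ} (hσ : 0 < σ) (m z : ℝ) :
    m + llr σ 0 z < 0 ↔ z < -(m * σ ^ 2 / 2 + 1) := by
  have hfactor : m + llr σ 0 z = 2 / σ ^ 2 * (z - -(m * σ ^ 2 / 2 + 1)) := by
    simp only [llr, bpsk, if_true]
    field_simp
    ring
  rw [hfactor, ← sub_neg (a := z), ← smul_eq_mul, smul_neg_iff_of_pos_left (by positivity)]

theorem noiseLaw_real_add_llr_neg {σ : ℝ} (hσ : 0 < σ) (m : ℝ) :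
    (noiseLaw σ).real {z | m + llr σ 0 z < 0} = gaussQ (σ / 2 * m + 1 / σ) := by
  simp only [add_llr_zero_neg_iff hσ]
  change (noiseLaw σ).real (Set.Iio _) = _
  rw [noiseLaw_real_Iio_neg hσ]
  congr 1
  field_simp

theorem hardBit_eq_one_iff (l : ℝ) : hardBit l = 1 ↔ l < 0 := by
  unfold hardBit; split_ifs with h <;> simp [h]

theorem hardBit_eq_zero_iff (l : ℝ) : hardBit l = 0 ↔ 0 ≤ l := by
  unfold hardBit; split_ifs with h <;> simp at h ⊢ <;> linarith

theorem hardBit_neg {l : ℝ} (hl : l ≠ 0) : hardBit (-l) = hardBit l + 1 := by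
  rcases lt_or_gt_of_ne hl with h | h
  · rw [(hardBit_eq_one_iff l).2 h, (hardBit_eq_zero_iff _).2 (by linarith)]; rfl
  · rw [(hardBit_eq_zero_iff l).2 h.le, (hardBit_eq_one_iff _).2 (by linarith)]; rfl

theorem measurable_hardBit : Measurable hardBit :=
  Measurable.ite measurableSet_Iio measurable_const measurable_const

theorem measurable_llr (σ : ℝ) (b : ZMod 2) : Measurable (llr σ b) := by
  unfold llr; fun_prop

/-- The noise values for which the hard decision on the transmitted bit `b` has the error bit `a`,
while the decision is wrong after the correction term `m` has been added to the LLR. -/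
def errorRegion (σ : ℝ) (b a : ZMod 2) (m : ℝ) : Set ℝ :=
  {z | hardBit (llr σ b z) = b + a ∧ hardBit (m + llr σ b z) = b + 1}

theorem measurableSet_errorRegion (σ : ℝ) (b a : ZMod 2) (m : ℝ) :
    MeasurableSet (errorRegion σ b a m) :=
  (measurable_hardBit.comp (measurable_llr σ b) (measurableSet_singleton _)).inter
    (measurable_hardBit.comp ((measurable_llr σ b).const_add m) (measurableSet_singleton _))

theorem noiseLaw_errorRegion_one {σ : ℝ} (hσ : 0 < σ) (m : ℝ) :
    (noiseLaw σ).real (errorRegion σ 0 1 m) = gaussQ (σ / 2 * max m 0 + 1 / σ) := by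
  rw [← noiseLaw_real_add_llr_neg hσ]
  congr 1
  ext z
  simp only [errorRegion, zero_add, hardBit_eq_one_iff, Set.mem_ofPred_eq, max_add, max_lt_iff,
    and_comm]

theorem noiseLaw_errorRegion_zero {σ : ℝ} (hσ : 0 < σ) (m : ℝ) :
    (noiseLaw σ).real (errorRegion σ 0 0 m) =
      (gaussQ (σ / 2 * m + 1 / σ) - gaussQ (1 / σ)) * ubar m := by
  rcases lt_or_ge m 0 with hm | hm
  · have hdiff : errorRegion σ 0 0 m = {z | m + llr σ 0 z < 0} \ {z | 0 + llr σ 0 z < 0} := by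
      ext z
      simp [errorRegion, hardBit_eq_one_iff, hardBit_eq_zero_iff, and_comm]
    have hsubset : {z | 0 + llr σ 0 z < 0} ⊆ {z | m + llr σ 0 z < 0} := fun z hz =>
      (add_lt_add_left hm _).trans hz
    have hmeas : MeasurableSet {z | 0 + llr σ 0 z < 0} :=
      measurableSet_lt ((measurable_llr σ 0).const_add 0) measurable_const
    rw [hdiff, measureReal_sdiff hsubset hmeas, noiseLaw_real_add_llr_neg hσ,
      noiseLaw_real_add_llr_neg hσ, ubar, if_pos hm, mul_one, mul_zero, zero_add]
  · have hempty : errorRegion σ 0 0 m = ∅ := by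
      ext z
      simp only [errorRegion, zero_add, hardBit_eq_one_iff, hardBit_eq_zero_iff, Set.mem_ofPred_eq,
        Set.mem_empty_iff_false, iff_false, not_and, not_lt]
      exact add_nonneg hm
    rw [hempty, measureReal_empty, ubar, if_neg hm.not_gt, mul_zero]

theorem llr_one_neg (σ z : ℝ) : llr σ 1 (-z) = -llr σ 0 z := by
  simp [llr, bpsk]; ring

theorem ae_add_llr_zero_ne_zero {σ : ℝ} (hσ : 0 < σ) (m : ℝ) :
    ∀ᵐ z ∂noiseLaw σ, m + llr σ 0 z ≠ 0 := by
  have := nullSingletonClass_gaussianReal (μ := 0) (v := (σ ^ 2).toNNReal) (by simpa using hσ.ne')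
  have hinj : Function.Injective fun z => m + llr σ 0 z := fun x y hxy => by
    simpa [llr, hσ.ne'] using hxy
  have hnull : noiseLaw σ {z | m + llr σ 0 z = 0} = 0 :=
    (Set.subsingleton_singleton.preimage hinj).measure_zero _
  simpa [ae_iff] using hnull

theorem noiseLaw_errorRegion_flip {σ : ℝ} (hσ : 0 < σ) (a : ZMod 2) (m : ℝ) :
    (noiseLaw σ).real (errorRegion σ 1 a (-m)) = (noiseLaw σ).real (errorRegion σ 0 a m) := by
  conv_lhs => rw [← noiseLaw_map_neg]
  rw [map_measureReal_apply measurable_neg (measurableSet_errorRegion _ _ _ _)]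
  refine measureReal_congr ?_
  filter_upwards [ae_add_llr_zero_ne_zero hσ 0, ae_add_llr_zero_ne_zero hσ m] with z hz hmz
  rw [zero_add] at hz
  change (hardBit (llr σ 1 (-z)) = 1 + a ∧ hardBit (-m + llr σ 1 (-z)) = 1 + 1) =
    (hardBit (llr σ 0 z) = 0 + a ∧ hardBit (m + llr σ 0 z) = 0 + 1)
  rw [llr_one_neg, ← neg_add, hardBit_neg hz, hardBit_neg hmz, add_comm 1 a, add_left_inj,
    add_left_inj, zero_add, zero_add]

/-! ### The density evolution step -/

/-- The probability that a constraint node message is wrong, if the all-zero codeword is sent, the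
correction table is `μ` and the incoming messages are independently wrong with probability `x`. The
sum runs over the outputs `u` of bounded distance decoding and the error bits `a` of the channel
hard decision. -/
def oneStep (C : LinCode n) (t : ℕ) (σ : ℝ) (μ : Lut) (x : ℝ) : ℝ :=
  ∑ u : SignType, ∑ a : ZMod 2,
    (noiseLaw σ).real (errorRegion σ 0 a (μ u (bitSign a))) * mix n (outcomeProb C t a u) x

/-- `μ` consists of the log-likelihood ratios of the transmitted bit given the output of bounded
distance decoding, for incoming messages that are independently wrong with probability `x`. The
table is indexed by the error bit `a` of the channel hard decision if the transmitted bit is `0`. If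
it is `1`, the error bit is `a + 1`, and `u` is wrong exactly if `-u` would be wrong for a `0`. -/
def IsLogRatioLut (C : LinCode n) (t : ℕ) (x : ℝ) (μ : Lut) : Prop :=
  ∀ u a, μ u (bitSign a) =
    Real.log (mix n (outcomeProb C t a u) x / mix n (outcomeProb C t (a + 1) (-u)) x)

/-- Antipodal symmetry of a correction table: flipping both arguments flips the correction term. -/
def OddLut (μ : Lut) : Prop :=
  ∀ u a, μ (-u) (bitSign (a + 1)) = -μ u (bitSign a)

theorem OddLut.noiseLaw_errorRegion {μ : Lut} (hμ : OddLut μ) {σ : ℝ} (hσ : 0 < σ) (b a : ZMod 2)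
    (u : SignType) :
    (noiseLaw σ).real (errorRegion σ b a (μ (bitSign b * u) (bitSign (b + a)))) =
      (noiseLaw σ).real (errorRegion σ 0 a (μ u (bitSign a))) := by
  have hone : bitSign 1 = -1 := rfl
  rcases eq_zero_or_eq_one b with rfl | rfl
  · simp [bitSign]
  · rw [← noiseLaw_errorRegion_flip hσ, ← hμ, hone, neg_one_mul, add_comm]

section IsLogRatioLut

variable {C : LinCode n} {t : ℕ} {x : ℝ} {μ : Lut}

theorem IsLogRatioLut.oddLut (h : IsLogRatioLut C t x μ) : OddLut μ := fun u a => by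
  rw [h, h, add_assoc, ZModModule.add_self, add_zero, neg_neg, ← Real.log_inv, inv_div]

theorem IsLogRatioLut.table (h : IsLogRatioLut C t x μ) :
    μ (-1) (-1) = Real.log (fPe C t x / fQc C t x) ∧
      μ 1 (-1) = Real.log (fPc C t x / fQe C t x) ∧
      μ 0 (-1) = Real.log (fPz C t x / fQz C t x) ∧
      μ (-1) 1 = Real.log (fQe C t x / fPc C t x) ∧
      μ 1 1 = Real.log (fQc C t x / fPe C t x) ∧
      μ 0 1 = Real.log (fQz C t x / fPz C t x) :=
  ⟨h (-1) 1, h 1 1, h 0 1, h (-1) 0, h 1 0, h 0 0⟩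

theorem IsLogRatioLut.oneStep_eq_deStep {σ : ℝ} (hσ : 0 < σ) (h : IsLogRatioLut C t x μ) :
    oneStep C t σ μ x = deStep C t σ x := by
  obtain ⟨hPe, hPc, hPz, hQe, hQc, hQz⟩ := h.table
  have hsum : ∀ f : ZMod 2 → ℝ, ∑ a, f a = f 0 + f 1 := Fin.sum_univ_two
  have hzero : bitSign 0 = 1 := rfl
  have hone : bitSign 1 = -1 := rfl
  simp only [oneStep, sum_signType, hsum, hzero, hone, noiseLaw_errorRegion_one hσ,
    noiseLaw_errorRegion_zero hσ, hPe, hPc, hPz, hQe, hQc, hQz]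
  change _ * fQz C t x + _ * fPz C t x + (_ * fQe C t x + _ * fPe C t x) +
    (_ * fQc C t x + _ * fPc C t x) = _
  rw [deStep]
  ring

end IsLogRatioLut

/-! ### Independence -/

section Independence

variable {ι Ω : Type*} {X : ι → Type*} {z : ∀ i, Ω → X i}

theorem comp_eq_updateFinset_of_dependsOn [DecidableEq ι] {β : Type*} {f : (∀ i, X i) → β}
    {D : Finset ι} (hfD : DependsOn f D) (x₀ : ∀ i, X i) :
    (fun ω => f fun i => z i ω) =
      (fun y => f (Function.updateFinset x₀ D y)) ∘ fun ω (i : D) => z i ω := by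
  ext ω
  exact hfD fun i hi => by simp [Function.updateFinset, Finset.mem_coe.1 hi]

variable [MeasurableSpace Ω] {P : Measure Ω}

theorem measureReal_eq_sum_inter_preimage_singleton [IsFiniteMeasure P] {β : Type*} [Fintype β]
    {f : Ω → β} (hf : ∀ b, MeasurableSet (f ⁻¹' {b})) (E : Set Ω) :
    P.real E = ∑ b, P.real (E ∩ f ⁻¹' {b}) := by
  have hsum := sum_measureReal_preimage_singleton (μ := P.restrict E) Finset.univ fun b _ => hf b
  simpa [measureReal_restrict_apply, hf, Set.inter_comm] using hsum.symm

variable [∀ i, MeasurableSpace (X i)]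

theorem indepFun_comp_of_dependsOn [∀ i, Nonempty (X i)] (hz : ∀ i, Measurable (z i))
    (hind : iIndepFun z P) {β γ : Type*} [MeasurableSpace β] [MeasurableSpace γ]
    {f : (∀ i, X i) → β} {g : (∀ i, X i) → γ} (hf : Measurable f) (hg : Measurable g)
    {D E : Finset ι} (hfD : DependsOn f D) (hgE : DependsOn g E) (hDE : Disjoint D E) :
    IndepFun (fun ω => f fun i => z i ω) (fun ω => g fun i => z i ω) P := by
  classical
  let x₀ : ∀ i, X i := fun _ => Classical.arbitrary _
  rw [comp_eq_updateFinset_of_dependsOn hfD x₀, comp_eq_updateFinset_of_dependsOn hgE x₀]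
  exact (hind.indepFun_finset D E hDE hz).comp (hf.comp measurable_updateFinset)
    (hg.comp measurable_updateFinset)

theorem iIndepFun_comp_of_dependsOn [∀ i, Nonempty (X i)] (hz : ∀ i, Measurable (z i))
    (hind : iIndepFun z P) {κ : Type*} {β : κ → Type*} [∀ k, MeasurableSpace (β k)]
    {f : ∀ k, (∀ i, X i) → β k} (hf : ∀ k, Measurable (f k)) {D : κ → Finset ι}
    (hfD : ∀ k, DependsOn (f k) (D k)) (hD : Pairwise (Function.onFun Disjoint D)) :
    iIndepFun (fun k ω => f k fun i => z i ω) P := by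
  classical
  have := hind.isProbabilityMeasure
  refine iIndepFun_iff_measure_inter_preimage_eq_mul.2 fun s => ?_
  induction s using Finset.induction_on with
  | empty => simp
  | insert a s ha ih =>
    intro A hA
    have hs : DependsOn (fun y (k : s) => f k y) (s.biUnion D) := fun x y hxy => by
      ext k
      exact hfD k fun i hi => hxy i (Finset.mem_biUnion.2 ⟨k, k.2, hi⟩)
    have hdisj : Disjoint (D a) (s.biUnion D) := (Finset.disjoint_biUnion_right _ _ _).2
      fun k hk => hD fun hak => ha (hak ▸ hk)
    have hindep := indepFun_comp_of_dependsOn hz hind (hf a)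
      (measurable_pi_lambda _ fun k : s => hf k) (hfD a) hs hdisj
    have hpre : ⋂ k ∈ s, (fun ω => f k fun i => z i ω) ⁻¹' A k =
        (fun ω (k : s) => f k fun i => z i ω) ⁻¹' Set.univ.pi fun k : s => A k := by
      ext ω
      simp [Set.mem_pi]
    rw [Finset.set_biInter_insert, hpre, hindep.measure_inter_preimage_eq_mul _ _
      (hA a (Finset.mem_insert_self a s)) (MeasurableSet.univ_pi fun k =>
        hA k (Finset.mem_insert_of_mem k.2)), ← hpre, ih fun k hk =>
      hA k (Finset.mem_insert_of_mem hk), Finset.prod_insert ha]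

end Independence

/-! ### Bounded distance decoding of independent errors -/

section Errors

variable {Ω : Type*} [MeasurableSpace Ω] {P : Measure Ω}

theorem measureReal_forall_eq_one_iff_mem {κ : Type*} [Fintype κ] {e : κ → Ω → ZMod 2}
    (he : ∀ k, Measurable (e k)) (hind : iIndepFun e P) {x : ℝ}
    (hx : ∀ k, P.real {ω | e k ω = 1} = x) (S : Finset κ) :
    P.real {ω | ∀ k, e k ω = 1 ↔ k ∈ S} = x ^ S.card * (1 - x) ^ (Fintype.card κ - S.card) := by
  classical
  have := hind.isProbabilityMeasure
  have hfactor : ∀ k, P.real (e k ⁻¹' {b | b = 1 ↔ k ∈ S}) = if k ∈ S then x else 1 - x := by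
    intro k
    split_ifs with hk
    · simpa [hk] using! hx k
    · have hcompl := probReal_compl_eq_one_sub (μ := P) (he k (measurableSet_singleton 1))
      rw [← hx k]
      simpa [hk] using! hcompl
  have hinter : {ω | ∀ k, e k ω = 1 ↔ k ∈ S} =
      ⋂ k ∈ Finset.univ, e k ⁻¹' {b | b = 1 ↔ k ∈ S} := by
    ext ω
    simp
  rw [hinter, measureReal_def, hind.measure_inter_preimage_eq_mul Finset.univ
    fun k _ => Set.Finite.measurableSet (Set.toFinite _), ENNReal.toReal_prod]
  simp_rw [← measureReal_def, hfactor]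
  rw [Finset.prod_ite, Finset.prod_const, Finset.prod_const, Finset.filter_mem_eq_inter,
    Finset.univ_inter, Finset.filter_notMem_eq_sdiff, ← Finset.compl_eq_univ_sdiff,
    Finset.card_compl]

/-- By transitivity of the automorphism group, the output on a fixed position is distributed as on
a uniformly random one. -/
theorem measureReal_extBdd_eq_mix {C : LinCode n} (hCt : HasTransitiveAut C) (t : ℕ) {j : Fin n}
    {e : Fin n → Ω → ZMod 2} (he : ∀ i ≠ j, Measurable (e i))
    (hind : iIndepFun (fun i : {i // i ≠ j} => e i) P) {x : ℝ}
    (hx : ∀ i ≠ j, P.real {ω | e i ω = 1} = x) (a : ZMod 2) (u : SignType) :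
    P.real {ω | extBdd C t (fun i => e i ω) j a = u} = mix n (outcomeProb C t a u) x := by
  classical
  have := hind.isProbabilityMeasure
  let N : Ω → Finset (Fin n) := fun ω => {i | i ≠ j ∧ e i ω = 1}
  have hN : ∀ S ⊆ Finset.univ.erase j, N ⁻¹' {S} =
      {ω | ∀ i : {i // i ≠ j}, e i ω = 1 ↔ i ∈ S.subtype (· ≠ j)} := fun S hS => by
    ext ω
    have hj : j ∉ S := fun h => by simpa using hS h
    simp only [N, Set.mem_preimage, Set.mem_singleton_iff, Finset.ext_iff, Finset.mem_filter,
      Finset.mem_univ, true_and, Set.mem_ofPred_eq, Finset.mem_subtype, Subtype.forall]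
    exact forall_congr' fun i => by by_cases hij : i = j <;> simp [hij, hj]
  have hpattern : ∀ S ⊆ Finset.univ.erase j,
      P.real (N ⁻¹' {S}) = x ^ S.card * (1 - x) ^ (n - 1 - S.card) := fun S hS => by
    have hcard : (S.subtype (· ≠ j)).card = S.card := by
      rw [Finset.card_subtype, Finset.filter_true_of_mem fun i hi => Finset.ne_of_mem_erase (hS hi)]
    rw [hN S hS, measureReal_forall_eq_one_iff_mem 
      (fun i : {i // i ≠ j} => he i i.2) hind (fun i : {i // i ≠ j} => hx i i.2), hcard]
    simp
  have hmeas : ∀ S ∈ (Finset.univ.erase j).powerset.filter fun S => bdd C t (errWord a j S) j = u,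
      MeasurableSet (N ⁻¹' {S}) := fun S hS => by
    rw [hN S (Finset.mem_powerset.1 (Finset.mem_filter.1 hS).1), Set.ofPred_forall]
    refine MeasurableSet.iInter fun i => ?_
    exact he i i.2 (Set.toFinite {b | b = 1 ↔ i ∈ S.subtype (· ≠ j)}).measurableSet
  have hevent : {ω | extBdd C t (fun i => e i ω) j a = u} = N ⁻¹'
      ((Finset.univ.erase j).powerset.filter fun S => bdd C t (errWord a j S) j = u) := by
    ext ω
    have hsub : N ω ⊆ Finset.univ.erase j := fun i hi => by
      simpa [N] using (Finset.mem_filter.1 hi).2.1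
    simp [extBdd_eq_bdd_errWord, N, hsub]
  rw [hevent, ← sum_measureReal_preimage_singleton _ hmeas, mix_outcomeProb hCt t a u j x]
  exact Finset.sum_congr rfl fun S hS =>
    hpattern S (Finset.mem_powerset.1 (Finset.mem_filter.1 hS).1)

end Errors

/-! ### Independent Gaussian noise -/

section AWGN

variable {ι Ω : Type*} [MeasurableSpace Ω]

/-- The family `z` is additive white Gaussian noise of variance `σ²`. -/
structure IsAWGN (σ : ℝ) (z : ι → Ω → ℝ) (P : Measure Ω) : Prop where
  measurable (v : ι) : Measurable (z v)
  iIndepFun : iIndepFun z P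
  map_eq (v : ι) : P.map (z v) = noiseLaw σ

theorem IsAWGN.real_preimage {σ : ℝ} {z : ι → Ω → ℝ} {P : Measure Ω} (hz : IsAWGN σ z P) (v : ι)
    {A : Set ℝ} (hA : MeasurableSet A) : P.real (z v ⁻¹' A) = (noiseLaw σ).real A := by
  rw [← hz.map_eq v, map_measureReal_apply (hz.measurable v) hA]

theorem isAWGN_eval_pi [Fintype ι] (σ : ℝ) :
    IsAWGN σ (fun (v : ι) (z : ι → ℝ) => z v) (Measure.pi fun _ => noiseLaw σ) where
  measurable := measurable_pi_apply
  iIndepFun := iIndepFun_pi (X := fun _ => id) fun _ => aemeasurable_id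
  map_eq v := (measurePreserving_eval (fun _ : ι => noiseLaw σ) v).map_eq

end AWGN

/-! ### Message passing -/

/-- The channel LLRs when the word `w` is sent and the noise is `y`. -/
def channelLlr {ι : Type*} (σ : ℝ) (w : ι → ZMod 2) (y : ι → ℝ) (v : ι) : ℝ :=
  llr σ (w v) (y v)

theorem measurable_channelLlr {ι : Type*} (σ : ℝ) (w : ι → ZMod 2) : Measurable (channelLlr σ w) :=
  measurable_pi_lambda _ fun v => (measurable_llr σ (w v)).comp (measurable_pi_apply v)

/-- The density evolution sequence of the correction tables `μ 1, μ 2, …`. -/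
def deSeq (C : LinCode n) (t : ℕ) (σ : ℝ) (μ : ℕ → Lut) : ℕ → ℝ
  | 0 => gaussQ (1 / σ)
  | h + 1 => oneStep C t σ (μ (h + 1)) (deSeq C t σ μ h)

/-- The schedule of an iterative decoder with component codes of length `n`. In half-iteration
`h + 1`, the message on the variable node `v` comes from a constraint node that has `v` at position
`pos h v`, and `nbr h v i` at every other position `i`; the value `nbr h v (pos h v)` is irrelevant.
Both the computation tree and the graphs of the ensemble are of this form. -/
structure DecodingGraph (n : ℕ) (ι : Type*) where
  nbr : ℕ → ι → Fin n → ι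
  pos : ℕ → ι → Fin n

namespace DecodingGraph

variable {ι : Type*} (G : DecodingGraph n ι)

/-- The words that satisfy all constraint nodes. -/
def IsCodeword (C : LinCode n) (w : ι → ZMod 2) : Prop :=
  ∀ h v, (fun i => if i = G.pos h v then w v else w (G.nbr h v i)) ∈ C

/-- The message on `v` after `h` half-iterations for the channel LLRs `l`. -/
def msg (C : LinCode n) (t : ℕ) (μ : ℕ → Lut) (l : ι → ℝ) : ℕ → ι → ZMod 2
  | 0, v => hardBit (l v)
  | h + 1, v => cnMsg C t (μ (h + 1)) (fun i => msg C t μ l h (G.nbr h v i)) (G.pos h v) (l v)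

/-- The output of bounded distance decoding on `v` in half-iteration `h + 1`. -/
def bddOut (C : LinCode n) (t : ℕ) (μ : ℕ → Lut) (l : ι → ℝ) (h : ℕ) (v : ι) : SignType :=
  extBdd C t (fun i => msg G C t μ l h (G.nbr h v i)) (G.pos h v) (hardBit (l v))

open Classical in
/-- The nodes whose LLRs determine the message on `v` after `h` half-iterations. -/
def support : ℕ → ι → Finset ι
  | 0, v => {v}
  | h + 1, v => insert v ((Finset.univ.erase (G.pos h v)).biUnion fun i => support h (G.nbr h v i))

/-- The nodes that determine the message on `v` after `h` half-iterations form a tree. -/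
def IsTreeLike : ℕ → ι → Prop
  | 0, _ => True
  | h + 1, v =>
    (∀ i ≠ G.pos h v, IsTreeLike h (G.nbr h v i) ∧ v ∉ G.support h (G.nbr h v i)) ∧
      {i | i ≠ G.pos h v}.PairwiseDisjoint fun i => G.support h (G.nbr h v i)

/-- The error bit of the message on `v` after `h` half-iterations, if `w` is sent and the noise is
`y`. -/
def msgError (C : LinCode n) (t : ℕ) (μ : ℕ → Lut) (σ : ℝ) (w : ι → ZMod 2) (h : ℕ) (y : ι → ℝ)
    (v : ι) : ZMod 2 :=
  G.msg C t μ (channelLlr σ w y) h v + w v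

variable (C : LinCode n) (t : ℕ)

theorem msg_congr_lut {μ μ' : ℕ → Lut} (l : ι → ℝ) {h : ℕ} (hμ : ∀ k < h, μ (k + 1) = μ' (k + 1))
    (v : ι) : G.msg C t μ l h v = G.msg C t μ' l h v := by
  induction h generalizing v with
  | zero => rfl
  | succ h ih =>
    simp only [msg, hμ h h.lt_succ_self, ih fun k hk => hμ k (hk.trans h.lt_succ_self)]

theorem dependsOn_msg (μ : ℕ → Lut) (h : ℕ) (v : ι) :
    DependsOn (fun l => G.msg C t μ l h v) (G.support h v) := by
  classical
  induction h generalizing v with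
  | zero => exact fun l l' hl => congrArg hardBit (hl v (by simp [support]))
  | succ h ih =>
    intro l l' hl
    have hroot : l v = l' v := hl v (by simp [support])
    have hnbr : ∀ i ∈ ({G.pos h v}ᶜ : Set (Fin n)),
        G.msg C t μ l h (G.nbr h v i) = G.msg C t μ l' h (G.nbr h v i) := fun i hi =>
      ih _ fun u hu => hl u (Finset.mem_insert_of_mem
        (Finset.mem_biUnion.2 ⟨i, by simpa using hi, hu⟩))
    simp only [msg, cnMsg, hroot, dependsOn_extBdd C t _ _ hnbr]

variable (μ : ℕ → Lut) (σ : ℝ) (w : ι → ZMod 2)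

theorem dependsOn_msgError (h : ℕ) (v : ι) :
    DependsOn (fun y => G.msgError C t μ σ w h y v) (G.support h v) := fun y y' hy =>
  congrArg (· + w v) (G.dependsOn_msg C t μ h v fun u hu => by simp only [channelLlr, hy u hu])

theorem measurable_msg (h : ℕ) (v : ι) : Measurable fun l => G.msg C t μ l h v := by
  induction h generalizing v with
  | zero => exact measurable_hardBit.comp (measurable_pi_apply v)
  | succ h ih =>
    have hin : Measurable fun l : ι → ℝ =>
        ((fun i => G.msg C t μ l h (G.nbr h v i)), hardBit (l v)) :=
      (measurable_pi_lambda _ fun i => ih _).prodMk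
        (measurable_hardBit.comp (measurable_pi_apply v))
    have hlut : Measurable fun q : (Fin n → ZMod 2) × ZMod 2 =>
        μ (h + 1) (extBdd C t q.1 (G.pos h v) q.2) (bitSign q.2) := Measurable.of_discrete
    simp only [msg, cnMsg, hardSign_eq_bitSign]
    exact measurable_hardBit.comp ((hlut.comp hin).add (measurable_pi_apply v))

theorem measurableSet_bddOut_eq (h : ℕ) (v : ι) (u : SignType) :
    MeasurableSet {l | G.bddOut C t μ l h v = u} := by
  have hin : Measurable fun l : ι → ℝ =>
      ((fun i => G.msg C t μ l h (G.nbr h v i)), hardBit (l v)) :=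
    (measurable_pi_lambda _ fun i => G.measurable_msg C t μ h _).prodMk
      (measurable_hardBit.comp (measurable_pi_apply v))
  exact hin (MeasurableSet.of_discrete
    (s := {q : (Fin n → ZMod 2) × ZMod 2 | extBdd C t q.1 (G.pos h v) q.2 = u}))

theorem measurable_msgError (h : ℕ) (v : ι) :
    Measurable fun y => G.msgError C t μ σ w h y v :=
  ((G.measurable_msg C t μ h v).comp (measurable_channelLlr σ w)).add_const _

variable {G C t μ σ w}

theorem msgError_eq_one_iff {h : ℕ} {y : ι → ℝ} {v : ι} :
    G.msgError C t μ σ w h y v = 1 ↔ G.msg C t μ (channelLlr σ w y) h v ≠ w v := by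
  rw [msgError, add_eq_one_iff_eq_add_one, ne_iff_eq_add_one]

theorem bddOut_eq_bitSign_mul_extBdd (hC : CorrectsErrors C t) (hw : G.IsCodeword C w) (h : ℕ)
    (v : ι) (y : ι → ℝ) :
    G.bddOut C t μ (channelLlr σ w y) h v = bitSign (w v) *
      extBdd C t (fun i => G.msgError C t μ σ w h y (G.nbr h v i)) (G.pos h v)
        (hardBit (llr σ (w v) (y v)) + w v) := by
  have hadd := extBdd_add hC (hw h v)
    (fun i => G.msgError C t μ σ w h y (G.nbr h v i)) (G.pos h v)
    (hardBit (llr σ (w v) (y v)) + w v)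
  simp only [if_true, add_assoc, ZModModule.add_self, add_zero] at hadd
  rw [← hadd]
  refine dependsOn_extBdd C t _ _ fun i hi => ?_
  have hi : i ≠ G.pos h v := hi
  simp [msgError, hi, add_assoc, ZModModule.add_self]

theorem msgError_succ_eq_one_iff (hC : CorrectsErrors C t) (hw : G.IsCodeword C w) (h : ℕ) (v : ι)
    (y : ι → ℝ) {a : ZMod 2} (ha : hardBit (llr σ (w v) (y v)) + w v = a) {u : SignType}
    (hu : extBdd C t (fun i => G.msgError C t μ σ w h y (G.nbr h v i)) (G.pos h v) a = u) :
    G.msgError C t μ σ w (h + 1) y v = 1 ↔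
      y v ∈ errorRegion σ (w v) a (μ (h + 1) (bitSign (w v) * u) (bitSign (w v + a))) := by
  have hbit : hardBit (llr σ (w v) (y v)) = w v + a := by
    rw [← ha, add_left_comm, ZModModule.add_self, add_zero]
  have hout : G.bddOut C t μ (channelLlr σ w y) h v = bitSign (w v) * u := by
    rw [bddOut_eq_bitSign_mul_extBdd hC hw, ha, hu]
  have hmsg : G.msg C t μ (channelLlr σ w y) (h + 1) v =
      hardBit (μ (h + 1) (bitSign (w v) * u) (bitSign (w v + a)) + llr σ (w v) (y v)) := by
    rw [← hout, ← hbit, ← hardSign_eq_bitSign]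
    rfl
  rw [msgError, hmsg, add_eq_one_iff_eq_add_one, errorRegion, Set.mem_ofPred_eq, and_iff_right hbit]

theorem msgError_succ_eq_one_and_iff (hC : CorrectsErrors C t) (hw : G.IsCodeword C w) (h : ℕ)
    (v : ι) (y : ι → ℝ) (a : ZMod 2) (u : SignType) :
    (G.msgError C t μ σ w (h + 1) y v = 1 ∧ hardBit (llr σ (w v) (y v)) + w v = a ∧
      extBdd C t (fun i => G.msgError C t μ σ w h y (G.nbr h v i)) (G.pos h v) a = u) ↔
    y v ∈ errorRegion σ (w v) a (μ (h + 1) (bitSign (w v) * u) (bitSign (w v + a))) ∧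
      extBdd C t (fun i => G.msgError C t μ σ w h y (G.nbr h v i)) (G.pos h v) a = u := by
  constructor
  · rintro ⟨herr, ha, hu⟩
    exact ⟨(msgError_succ_eq_one_iff hC hw h v y ha hu).1 herr, hu⟩
  · rintro ⟨hroot, hu⟩
    have ha : hardBit (llr σ (w v) (y v)) + w v = a :=
      (ZModModule.sub_eq_add _ _).symm.trans (sub_eq_iff_eq_add'.2 hroot.1)
    exact ⟨(msgError_succ_eq_one_iff hC hw h v y ha hu).2 hroot, ha, hu⟩

/-! ### Density evolution -/

variable {Ω : Type*} [MeasurableSpace Ω] {P : Measure Ω} {z : ι → Ω → ℝ}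

theorem IsTreeLike.iIndepFun_msgError (hz : IsAWGN σ z P) {h : ℕ} {v : ι}
    (htree : G.IsTreeLike (h + 1) v) :
    iIndepFun (fun (i : {i // i ≠ G.pos h v}) ω =>
      G.msgError C t μ σ w h (fun v => z v ω) (G.nbr h v i)) P :=
  iIndepFun_comp_of_dependsOn hz.measurable hz.iIndepFun
    (fun i : {i // i ≠ G.pos h v} => G.measurable_msgError C t μ σ w h (G.nbr h v i))
    (fun i => G.dependsOn_msgError C t μ σ w h (G.nbr h v i))
    fun i j hij => htree.2 i.2 j.2 fun hval => hij (Subtype.ext hval)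

theorem IsTreeLike.measureReal_inter_extBdd (hCt : HasTransitiveAut C) (hz : IsAWGN σ z P) {h : ℕ}
    {v : ι} (htree : G.IsTreeLike (h + 1) v) {x : ℝ}
    (hx : ∀ i ≠ G.pos h v,
      P.real {ω | G.msgError C t μ σ w h (fun v => z v ω) (G.nbr h v i) = 1} = x)
    {A : Set ℝ} (hA : MeasurableSet A) (a : ZMod 2) (u : SignType) :
    P.real {ω | z v ω ∈ A ∧ extBdd C t
        (fun i => G.msgError C t μ σ w h (fun v => z v ω) (G.nbr h v i)) (G.pos h v) a = u} =
      (noiseLaw σ).real A * mix n (outcomeProb C t a u) x := by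
  classical
  let out (y : ι → ℝ) : Prop :=
    extBdd C t (fun i => G.msgError C t μ σ w h y (G.nbr h v i)) (G.pos h v) a = u
  have hout : Measurable out :=
    (Measurable.of_discrete (f := fun q => extBdd C t q (G.pos h v) a = u)).comp
      (measurable_pi_lambda _ fun i => G.measurable_msgError C t μ σ w h (G.nbr h v i))
  have hdep : DependsOn out ((Finset.univ.erase (G.pos h v)).biUnion fun i =>
      G.support h (G.nbr h v i)) := fun y y' hy => by
    refine congrArg (· = u) (dependsOn_extBdd C t _ _ fun i hi => ?_)
    exact G.dependsOn_msgError C t μ σ w h _ fun k hk =>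
      hy k (Finset.mem_biUnion.2 ⟨i, by simpa using hi, hk⟩)
  have hroot : DependsOn (fun y : ι → ℝ => y v) ({v} : Finset ι) := fun y y' hy => hy v (by simp)
  have hdisj : Disjoint {v} ((Finset.univ.erase (G.pos h v)).biUnion fun i =>
      G.support h (G.nbr h v i)) := by
    simpa using fun i hi => (htree.1 i hi).2
  have hindep := indepFun_comp_of_dependsOn hz.measurable hz.iIndepFun (measurable_pi_apply v)
    hout hroot hdep hdisj
  rw [← hz.real_preimage v hA, ← measureReal_extBdd_eq_mix hCt t (fun i _ =>
    (G.measurable_msgError C t μ σ w h _).comp (measurable_pi_lambda _ hz.measurable))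
    (htree.iIndepFun_msgError hz) hx a u]
  have hmul := hindep.measure_inter_preimage_eq_mul A {True} hA (measurableSet_singleton _)
  simpa [measureReal_def, Set.ofPred_and, Set.preimage, out] using congrArg ENNReal.toReal hmul

theorem IsTreeLike.measureReal_bddOut (hC : CorrectsErrors C t) (hCt : HasTransitiveAut C)
    (hw : G.IsCodeword C w) (hz : IsAWGN σ z P) {h : ℕ} {v : ι} (htree : G.IsTreeLike (h + 1) v)
    {x : ℝ} (hx : ∀ i ≠ G.pos h v,
      P.real {ω | G.msgError C t μ σ w h (fun v => z v ω) (G.nbr h v i) = 1} = x)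
    (r : ZMod 2) (u : SignType) :
    P.real {ω | hardBit (llr σ (w v) (z v ω)) = r ∧
        G.bddOut C t μ (channelLlr σ w fun v => z v ω) h v = u} =
      (noiseLaw σ).real {y | hardBit (llr σ (w v) y) = r} *
        mix n (outcomeProb C t (r + w v) (bitSign (w v) * u)) x := by
  have hsign : ∀ (b : ZMod 2) (u u' : SignType), bitSign b * u = u' ↔ u = bitSign b * u' := by
    decide
  have hmeas : MeasurableSet {y | hardBit (llr σ (w v) y) = r} :=
    measurable_hardBit.comp (measurable_llr σ (w v)) (measurableSet_singleton r)
  rw [← htree.measureReal_inter_extBdd hCt hz hx hmeas]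
  congr 1
  ext ω
  simp only [Set.mem_ofPred_eq, bddOut_eq_bitSign_mul_extBdd hC hw, hsign]
  exact and_congr_right fun hr => by rw [hr]

theorem IsTreeLike.measureReal_msgError_succ (hC : CorrectsErrors C t) (hCt : HasTransitiveAut C)
    (hσ : 0 < σ) (hw : G.IsCodeword C w) (hz : IsAWGN σ z P) {h : ℕ} (hμ : OddLut (μ (h + 1)))
    {v : ι} (htree : G.IsTreeLike (h + 1) v) {x : ℝ} (hx : ∀ i ≠ G.pos h v,
      P.real {ω | G.msgError C t μ σ w h (fun v => z v ω) (G.nbr h v i) = 1} = x) :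
    P.real {ω | G.msgError C t μ σ w (h + 1) (fun v => z v ω) v = 1} =
      oneStep C t σ (μ (h + 1)) x := by
  have := hz.iIndepFun.isProbabilityMeasure
  let rootError (ω : Ω) : ZMod 2 := hardBit (llr σ (w v) (z v ω)) + w v
  let out (ω : Ω) (a : ZMod 2) : SignType :=
    extBdd C t (fun i => G.msgError C t μ σ w h (fun v => z v ω) (G.nbr h v i)) (G.pos h v) a
  have hmeas : ∀ k, MeasurableSet ((fun ω => (out ω (rootError ω), rootError ω)) ⁻¹' {k}) :=
      fun k => by
    have hin : Measurable fun ω =>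
        ((fun i => G.msgError C t μ σ w h (fun v => z v ω) (G.nbr h v i)), rootError ω) :=
      (measurable_pi_lambda _ fun i => (G.measurable_msgError C t μ σ w h _).comp
        (measurable_pi_lambda _ hz.measurable)).prodMk
        (((measurable_hardBit.comp (measurable_llr σ _)).comp (hz.measurable v)).add_const _)
    exact hin (MeasurableSet.of_discrete (s := {q | (extBdd C t q.1 (G.pos h v) q.2, q.2) = k}))
  have hfibre : ∀ k : SignType × ZMod 2,
      {ω | G.msgError C t μ σ w (h + 1) (fun v => z v ω) v = 1} ∩
        (fun ω => (out ω (rootError ω), rootError ω)) ⁻¹' {k} =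
      {ω | z v ω ∈ errorRegion σ (w v) k.2
          (μ (h + 1) (bitSign (w v) * k.1) (bitSign (w v + k.2))) ∧ out ω k.2 = k.1} := by
    rintro ⟨u, a⟩
    ext ω
    refine Iff.trans ?_ (msgError_succ_eq_one_and_iff hC hw h v (fun v => z v ω) a u)
    refine and_congr_right fun _ => Prod.mk_inj.trans (and_comm.trans ?_)
    exact and_congr_right fun ha => by rw [ha]
  rw [measureReal_eq_sum_inter_preimage_singleton hmeas, Fintype.sum_prod_type, oneStep]
  refine Finset.sum_congr rfl fun u _ => Finset.sum_congr rfl fun a _ => ?_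
  rw [hfibre, htree.measureReal_inter_extBdd hCt hz hx (measurableSet_errorRegion _ _ _ _),
    hμ.noiseLaw_errorRegion hσ]

theorem measureReal_hardBit_llr_ne {σ : ℝ} (hσ : 0 < σ) (b : ZMod 2) :
    (noiseLaw σ).real {y | hardBit (llr σ b y) ≠ b} = gaussQ (1 / σ) := by
  have hregion : {y | hardBit (llr σ b y) ≠ b} = errorRegion σ b 1 0 := by
    ext y
    simp [errorRegion, ne_iff_eq_add_one]
  have hzero : (noiseLaw σ).real (errorRegion σ 0 1 0) = gaussQ (1 / σ) := by
    simpa using noiseLaw_errorRegion_one hσ 0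
  rcases eq_zero_or_eq_one b with rfl | rfl
  · rw [hregion, hzero]
  · rw [hregion, ← hzero, ← noiseLaw_errorRegion_flip hσ, neg_zero]

theorem IsTreeLike.measureReal_msgError (hC : CorrectsErrors C t) (hCt : HasTransitiveAut C)
    (hσ : 0 < σ) (hw : G.IsCodeword C w) (hz : IsAWGN σ z P) {h : ℕ}
    (hμ : ∀ k < h, OddLut (μ (k + 1))) {v : ι} (htree : G.IsTreeLike h v) :
    P.real {ω | G.msgError C t μ σ w h (fun v => z v ω) v = 1} = deSeq C t σ μ h := by
  induction h generalizing v with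
  | zero =>
    have hmeas : MeasurableSet {y | hardBit (llr σ (w v) y) ≠ w v} :=
      (measurable_hardBit.comp (measurable_llr σ (w v)) (measurableSet_singleton _)).compl
    rw [deSeq, ← measureReal_hardBit_llr_ne hσ (w v), ← hz.real_preimage v hmeas]
    simp only [msgError_eq_one_iff]
    rfl
  | succ h ih =>
    exact htree.measureReal_msgError_succ hC hCt hσ hw hz (hμ h h.lt_succ_self) fun i hi =>
      ih (fun k hk => hμ k (hk.trans h.lt_succ_self)) (htree.1 i hi).1

theorem IsTreeLike.measureReal_msg_ne (hC : CorrectsErrors C t) (hCt : HasTransitiveAut C)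
    (hσ : 0 < σ) (hw : G.IsCodeword C w) (hz : IsAWGN σ z P) {h : ℕ}
    (hμ : ∀ k < h, OddLut (μ (k + 1))) {v : ι} (htree : G.IsTreeLike h v) :
    P.real {ω | G.msg C t μ (channelLlr σ w fun v => z v ω) h v ≠ w v} = deSeq C t σ μ h := by
  simpa only [msgError_eq_one_iff] using htree.measureReal_msgError hC hCt hσ hw hz hμ

end DecodingGraph

/-! ### The computation tree -/

theorem measureReal_mem_and_prodMk_mem_of_indepFun {Ω α β : Type*} [MeasurableSpace Ω]
    [MeasurableSpace α] [MeasurableSpace β] {P : Measure Ω} [IsProbabilityMeasure P] {c : Ω → α}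
    {z : Ω → β} (hc : Measurable c) (hz : Measurable z) (hcz : IndepFun c z P) {B : Set α}
    (hB : MeasurableSet B) {E : Set (α × β)} (hE : MeasurableSet E) {κ : ℝ}
    (hκ : ∀ ω, c ω ∈ B → P.real {ω' | (c ω, z ω') ∈ E} = κ) :
    P.real {ω | c ω ∈ B ∧ (c ω, z ω) ∈ E} = P.real (c ⁻¹' B) * κ := by
  have hlaw := (indepFun_iff_map_prod_eq_prod_map_map hc.aemeasurable hz.aemeasurable).1 hcz
  have := Measure.isProbabilityMeasure_map (μ := P) hc.aemeasurable
  have := Measure.isProbabilityMeasure_map (μ := P) hz.aemeasurable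
  have hsection : Measurable fun a => P.map z (Prod.mk a ⁻¹' E) := measurable_measure_prodMk_left hE
  calc P.real {ω | c ω ∈ B ∧ (c ω, z ω) ∈ E}
      = (P.map fun ω => (c ω, z ω)).real (E ∩ B ×ˢ Set.univ) := by
        rw [map_measureReal_apply (hc.prodMk hz) (hE.inter (hB.prod .univ))]
        congr 1
        ext ω
        simp [and_comm]
    _ = (((P.map c).restrict B).prod (P.map z)).real E := by
        rw [hlaw, ← measureReal_restrict_apply hE, ← Measure.prod_restrict, Measure.restrict_univ]
    _ = ∫ a in B, (P.map z).real (Prod.mk a ⁻¹' E) ∂P.map c := by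
        rw [measureReal_def, Measure.prod_apply hE, ← integral_toReal hsection.aemeasurable
          (.of_forall fun _ => measure_lt_top _ _)]
        rfl
    _ = ∫ ω in c ⁻¹' B, (P.map z).real (Prod.mk (c ω) ⁻¹' E) ∂P :=
        setIntegral_map hB hsection.ennreal_toReal.aestronglyMeasurable hc.aemeasurable
    _ = ∫ _ in c ⁻¹' B, κ ∂P := setIntegral_congr_fun (hc hB) fun ω hω => by
        simp only [map_measureReal_apply hz (measurable_prodMk_left hE)]
        exact hκ ω hω
    _ = P.real (c ⁻¹' B) * κ := by rw [setIntegral_const, smul_eq_mul]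

theorem noiseLaw_hardBit_ne_zero {σ : ℝ} (hσ : 0 < σ) (b r : ZMod 2) :
    (noiseLaw σ).real {y | hardBit (llr σ b y) = r} ≠ 0 := by
  have hac : volume ≪ noiseLaw σ := gaussianReal_absolutelyContinuous' 0 (by simpa using hσ.ne')
  have hscale : 0 < 2 / σ ^ 2 := by positivity
  rw [Ne, measureReal_eq_zero_iff]
  refine fun hnull => absurd (hac hnull) ?_
  rcases eq_zero_or_eq_one r with rfl | rfl
  · have hsub : Set.Ici (-bpsk b) ⊆ {y | hardBit (llr σ b y) = 0} := fun y hy =>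
      (hardBit_eq_zero_iff _).2 (mul_nonneg hscale.le (neg_le_iff_add_nonneg'.1 hy))
    exact fun h => by simpa using measure_mono_null hsub h
  · have hsub : Set.Iio (-bpsk b) ⊆ {y | hardBit (llr σ b y) = 1} := fun y hy =>
      (hardBit_eq_one_iff _).2 (mul_neg_of_pos_of_neg hscale (lt_neg_iff_add_neg'.1 hy))
    exact fun h => by simpa using measure_mono_null hsub h

/-- The computation tree with position labels `pos` as a decoding graph. -/
def treeGraph (pos : List (Fin n) → Fin n) : DecodingGraph n (List (Fin n)) where
  nbr _ v i := i :: v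
  pos _ := pos

section Tree

variable (C : LinCode n) (t : ℕ) (pos : List (Fin n) → Fin n)

theorem treeMsg_eq_msg (μ : ℕ → Lut) (l : List (Fin n) → ℝ) (h : ℕ) (v : List (Fin n)) :
    treeMsg C t pos μ l h v = (treeGraph pos).msg C t μ l h v := by
  induction h generalizing v with
  | zero => rfl
  | succ h ih => simp only [treeMsg, DecodingGraph.msg, ih]; rfl

theorem treeBdd_eq_bddOut (μ : ℕ → Lut) (l : List (Fin n) → ℝ) (h : ℕ) :
    treeBdd C t pos μ l h = (treeGraph pos).bddOut C t μ l h [] := by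
  simp only [treeBdd, treeMsg_eq_msg]; rfl

theorem suffix_of_mem_support_treeGraph {h : ℕ} {v u : List (Fin n)}
    (hu : u ∈ (treeGraph pos).support h v) : v <:+ u := by
  induction h generalizing v with
  | zero => simp [Finset.mem_singleton.1 hu]
  | succ h ih =>
    simp only [DecodingGraph.support, Finset.mem_insert, Finset.mem_biUnion] at hu
    rcases hu with rfl | ⟨i, _, hu⟩
    · exact List.suffix_rfl
    · exact (List.suffix_cons i v).trans (ih hu)

theorem isTreeLike_treeGraph (h : ℕ) (v : List (Fin n)) : (treeGraph pos).IsTreeLike h v := by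
  induction h generalizing v with
  | zero => trivial
  | succ h ih =>
    refine ⟨fun i _ => ⟨ih _, fun hv => ?_⟩, fun i _ j _ hij => ?_⟩
    · simpa [treeGraph] using (suffix_of_mem_support_treeGraph pos hv).length_le
    · refine Finset.disjoint_left.2 fun u hi hj => hij ?_
      have hsuffix := List.suffix_of_suffix_length_le (suffix_of_mem_support_treeGraph pos hi)
        (suffix_of_mem_support_treeGraph pos hj) le_rfl
      exact (List.cons.inj (hsuffix.eq_of_length rfl)).1

variable {Ω : Type*} [MeasurableSpace Ω] (P : Measure Ω) (σ : ℝ)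
  (c : Ω → List (Fin n) → ZMod 2) (z : Ω → List (Fin n) → ℝ)

theorem muUpTo_eq_muTilde {h k : ℕ} (hk : k ≤ h) :
    muUpTo P C t σ pos c z h k = muTilde P C t σ pos c z k := by
  induction h with
  | zero => rw [Nat.le_zero.1 hk]; rfl
  | succ h ih =>
    rcases hk.eq_or_lt with rfl | hlt
    · rfl
    · rw [muUpTo, Function.update_of_ne hlt.ne, ih (Nat.lt_succ_iff.1 hlt)]

theorem muTilde_succ (h : ℕ) (u s : SignType) :
    muTilde P C t σ pos c z (h + 1) u s =
      Real.log (condBdd P C t σ pos c z (muTilde P C t σ pos c z) h u s 0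
        / condBdd P C t σ pos c z (muTilde P C t σ pos c z) h u s 1) := by
  have hbdd (l) : treeBdd C t pos (muUpTo P C t σ pos c z h) l h =
      treeBdd C t pos (muTilde P C t σ pos c z) l h := by
    simp only [treeBdd, treeMsg_eq_msg, DecodingGraph.msg_congr_lut _ C t l fun _ hk =>
      muUpTo_eq_muTilde C t pos P σ c z (Nat.succ_le_of_lt hk)]
  simp only [muTilde, muUpTo, Function.update_self, condBdd, hbdd]

/-- The random codeword `c` of the computation tree is sent, with both root bits possible, and `z`
is the channel noise. -/
structure IsTreeTransmission (C : LinCode n) (pos : List (Fin n) → Fin n) (σ : ℝ) (P : Measure Ω)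
    (c : Ω → List (Fin n) → ZMod 2) (z : Ω → List (Fin n) → ℝ) : Prop where
  measurable : Measurable c
  isTreeCodeword (ω : Ω) : IsTreeCodeword C pos (c ω)
  measure_root_ne_zero (b : ZMod 2) : P {ω | c ω [] = b} ≠ 0
  isAWGN : IsAWGN σ (fun v ω => z ω v) P
  indepFun : IndepFun c z P

namespace IsTreeTransmission

variable {C t pos P σ c z}

theorem measurable_noise (hcz : IsTreeTransmission C pos σ P c z) : Measurable z :=
  measurable_pi_lambda _ hcz.isAWGN.measurable

theorem isCodeword (hcz : IsTreeTransmission C pos σ P c z) (ω : Ω) :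
    (treeGraph pos).IsCodeword C (c ω) := fun _ => hcz.isTreeCodeword ω

theorem measurable_jointLlr (σ : ℝ) :
    Measurable fun q : (List (Fin n) → ZMod 2) × (List (Fin n) → ℝ) => channelLlr σ q.1 q.2 := by
  have hbpsk : Measurable bpsk := Measurable.of_discrete
  refine measurable_pi_lambda _ fun v => ?_
  unfold channelLlr llr
  fun_prop

theorem msgErr_eq_deSeq [IsProbabilityMeasure P] (hcz : IsTreeTransmission C pos σ P c z)
    (hC : CorrectsErrors C t) (hCt : HasTransitiveAut C) (hσ : 0 < σ) {h : ℕ}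
    (hμ : ∀ k < h, OddLut (muTilde P C t σ pos c z (k + 1))) :
    msgErr P C t σ pos c z h = deSeq C t σ (muTilde P C t σ pos c z) h := by
  set μ := muTilde P C t σ pos c z with hμdef
  have hE : MeasurableSet {q : (List (Fin n) → ZMod 2) × (List (Fin n) → ℝ) |
      (treeGraph pos).msg C t μ (channelLlr σ q.1 q.2) h [] ≠ q.1 []} :=
    (measurableSet_eq_fun ((DecodingGraph.measurable_msg _ C t μ h []).comp
      (measurable_jointLlr σ)) (by fun_prop)).compl
  have key := measureReal_mem_and_prodMk_mem_of_indepFun hcz.measurable hcz.measurable_noise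
    hcz.indepFun .univ hE fun ω _ => (isTreeLike_treeGraph pos h []).measureReal_msg_ne hC hCt hσ
      (hcz.isCodeword ω) hcz.isAWGN hμ
  simpa [msgErr, treeMsg_eq_msg, ← hμdef, show treeLlr σ c z = fun ω => channelLlr σ (c ω) (z ω)
    from rfl] using key

theorem measurableSet_root_eq (b : ZMod 2) : MeasurableSet {w : List (Fin n) → ZMod 2 | w [] = b} :=
  measurableSet_eq_fun (measurable_pi_apply []) measurable_const

theorem measurableSet_root_hardBit_eq (σ : ℝ) (r : ZMod 2) :
    MeasurableSet {q : (List (Fin n) → ZMod 2) × (List (Fin n) → ℝ) |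
      hardBit (channelLlr σ q.1 q.2 []) = r} :=
  (measurable_hardBit.comp ((measurable_pi_apply []).comp (measurable_jointLlr σ)))
    (measurableSet_singleton r)

theorem measureReal_root_hardBit [IsProbabilityMeasure P]
    (hcz : IsTreeTransmission C pos σ P c z) (r b : ZMod 2) :
    P.real {ω | c ω [] = b ∧ hardBit (treeLlr σ c z ω []) = r} =
      P.real {ω | c ω [] = b} * (noiseLaw σ).real {y | hardBit (llr σ b y) = r} := by
  refine measureReal_mem_and_prodMk_mem_of_indepFun hcz.measurable hcz.measurable_noise
    hcz.indepFun (measurableSet_root_eq b) (measurableSet_root_hardBit_eq σ r) fun ω hω => ?_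
  have hω : c ω [] = b := hω
  simp only [Set.mem_ofPred_eq, channelLlr, hω]
  exact hcz.isAWGN.real_preimage []
    ((measurable_hardBit.comp (measurable_llr σ b)) (measurableSet_singleton r))

theorem measureReal_root_hardBit_bdd [IsProbabilityMeasure P]
    (hcz : IsTreeTransmission C pos σ P c z) (hC : CorrectsErrors C t) (hCt : HasTransitiveAut C)
    (hσ : 0 < σ) {μ : ℕ → Lut} {h : ℕ} (hμ : ∀ k < h, OddLut (μ (k + 1))) (u : SignType)
    (r b : ZMod 2) :
    P.real {ω | c ω [] = b ∧ hardBit (treeLlr σ c z ω []) = r ∧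
        treeBdd C t pos μ (treeLlr σ c z ω) h = u} =
      P.real {ω | c ω [] = b} * ((noiseLaw σ).real {y | hardBit (llr σ b y) = r} *
        mix n (outcomeProb C t (r + b) (bitSign b * u)) (deSeq C t σ μ h)) := by
  simp only [treeBdd_eq_bddOut]
  refine measureReal_mem_and_prodMk_mem_of_indepFun hcz.measurable hcz.measurable_noise
    hcz.indepFun (measurableSet_root_eq b) ((measurableSet_root_hardBit_eq σ r).inter
      (measurable_jointLlr σ (DecodingGraph.measurableSet_bddOut_eq _ C t μ h [] u)))
    fun ω hω => ?_
  have hω : c ω [] = b := hω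
  rw [← hω]
  exact (isTreeLike_treeGraph pos (h + 1) []).measureReal_bddOut hC hCt (hcz.isCodeword ω)
    hcz.isAWGN (fun i _ => (isTreeLike_treeGraph pos h [i]).measureReal_msgError hC hCt hσ
      (hcz.isCodeword ω) hcz.isAWGN hμ) r u

theorem condBdd_eq_mix [IsProbabilityMeasure P] (hcz : IsTreeTransmission C pos σ P c z)
    (hC : CorrectsErrors C t) (hCt : HasTransitiveAut C) (hσ : 0 < σ) {μ : ℕ → Lut} {h : ℕ}
    (hμ : ∀ k < h, OddLut (μ (k + 1))) (u : SignType) (r b : ZMod 2) :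
    condBdd P C t σ pos c z μ h u (bitSign r) b =
      mix n (outcomeProb C t (r + b) (bitSign b * u)) (deSeq C t σ μ h) := by
  have hevent : {ω | hardSign (treeLlr σ c z ω []) = bitSign r ∧ c ω [] = b} =
      {ω | c ω [] = b ∧ hardBit (treeLlr σ c z ω []) = r} := by
    ext ω
    simp only [Set.mem_ofPred_eq, hardSign_eq_bitSign, bitSign_injective.eq_iff, and_comm]
  have hmeas : MeasurableSet {ω | c ω [] = b ∧ hardBit (treeLlr σ c z ω []) = r} :=
    (hcz.measurable (measurableSet_root_eq b)).inter
      ((hcz.measurable.prodMk hcz.measurable_noise) (measurableSet_root_hardBit_eq σ r))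
  have hroot : P.real {ω | c ω [] = b} ≠ 0 := by
    rw [Ne, measureReal_eq_zero_iff]
    exact hcz.measure_root_ne_zero b
  have hhard := noiseLaw_hardBit_ne_zero hσ b r
  rw [condBdd, hevent, measureReal_def, cond_apply hmeas, ENNReal.toReal_mul, ENNReal.toReal_inv,
    ← measureReal_def, ← measureReal_def, hcz.measureReal_root_hardBit, ← Set.ofPred_and]
  simp only [and_assoc]
  rw [hcz.measureReal_root_hardBit_bdd hC hCt hσ hμ]
  field_simp

theorem isLogRatioLut_muTilde_succ [IsProbabilityMeasure P]
    (hcz : IsTreeTransmission C pos σ P c z) (hC : CorrectsErrors C t) (hCt : HasTransitiveAut C)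
    (hσ : 0 < σ) {h : ℕ} (hμ : ∀ k < h, OddLut (muTilde P C t σ pos c z (k + 1))) :
    IsLogRatioLut C t (deSeq C t σ (muTilde P C t σ pos c z) h)
      (muTilde P C t σ pos c z (h + 1)) := fun u a => by
  have hzero : bitSign 0 = 1 := rfl
  have hone : bitSign 1 = -1 := rfl
  rw [muTilde_succ, hcz.condBdd_eq_mix hC hCt hσ hμ, hcz.condBdd_eq_mix hC hCt hσ hμ, hzero, hone,
    add_zero, one_mul, neg_one_mul]

theorem oddLut_muTilde_succ [IsProbabilityMeasure P] (hcz : IsTreeTransmission C pos σ P c z)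
    (hC : CorrectsErrors C t) (hCt : HasTransitiveAut C) (hσ : 0 < σ) (h : ℕ) :
    OddLut (muTilde P C t σ pos c z (h + 1)) := by
  induction h using Nat.strong_induction_on with
  | _ h ih => exact (hcz.isLogRatioLut_muTilde_succ hC hCt hσ ih).oddLut

theorem msgErr_muTilde_eq_deSeq [IsProbabilityMeasure P] (hcz : IsTreeTransmission C pos σ P c z)
    (hC : CorrectsErrors C t) (hCt : HasTransitiveAut C) (hσ : 0 < σ) (h : ℕ) :
    msgErr P C t σ pos c z h = deSeq C t σ (muTilde P C t σ pos c z) h :=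
  hcz.msgErr_eq_deSeq hC hCt hσ fun k _ => hcz.oddLut_muTilde_succ hC hCt hσ k

theorem isLogRatioLut_msgErr [IsProbabilityMeasure P] (hcz : IsTreeTransmission C pos σ P c z)
    (hC : CorrectsErrors C t) (hCt : HasTransitiveAut C) (hσ : 0 < σ) (h : ℕ) :
    IsLogRatioLut C t (msgErr P C t σ pos c z h) (muTilde P C t σ pos c z (h + 1)) := by
  rw [hcz.msgErr_muTilde_eq_deSeq hC hCt hσ]
  exact hcz.isLogRatioLut_muTilde_succ hC hCt hσ fun k _ => hcz.oddLut_muTilde_succ hC hCt hσ k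

theorem condBdd_muTilde_eq_mix_msgErr [IsProbabilityMeasure P]
    (hcz : IsTreeTransmission C pos σ P c z) (hC : CorrectsErrors C t) (hCt : HasTransitiveAut C)
    (hσ : 0 < σ) (h : ℕ) (u : SignType) (r b : ZMod 2) :
    condBdd P C t σ pos c z (muTilde P C t σ pos c z) h u (bitSign r) b =
      mix n (outcomeProb C t (r + b) (bitSign b * u)) (msgErr P C t σ pos c z h) := by
  rw [hcz.msgErr_muTilde_eq_deSeq hC hCt hσ]
  exact hcz.condBdd_eq_mix hC hCt hσ (fun k _ => hcz.oddLut_muTilde_succ hC hCt hσ k) u r b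

theorem msgErr_succ [IsProbabilityMeasure P] (hcz : IsTreeTransmission C pos σ P c z)
    (hC : CorrectsErrors C t) (hCt : HasTransitiveAut C) (hσ : 0 < σ) (h : ℕ) :
    msgErr P C t σ pos c z (h + 1) = deStep C t σ (msgErr P C t σ pos c z h) := by
  rw [← (hcz.isLogRatioLut_msgErr hC hCt hσ h).oneStep_eq_deStep hσ,
    hcz.msgErr_muTilde_eq_deSeq hC hCt hσ, hcz.msgErr_muTilde_eq_deSeq hC hCt hσ, deSeq]

end IsTreeTransmission

end Tree

/-! ### Neighbourhoods in random graphs -/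

section Sockets

variable {V K S : Type*}

/-- In the graph where the variable node `v` has the socket `ρ s v` of type `s`, the first component
of the socket being the constraint node, `f` and `g` are distinct and lie on the same constraint
node of type `s`. -/
def IsNeighbor (ρ : S → V ≃ K × Fin n) (s : S) (f g : V) : Prop :=
  f ≠ g ∧ (ρ s f).1 = (ρ s g).1

variable {ρ : S → V ≃ K × Fin n} {T : ℕ → S} {e f g : V}

theorem IsNeighbor.symm {s : S} (h : IsNeighbor ρ s f g) : IsNeighbor ρ s g f :=
  ⟨h.1.symm, h.2.symm⟩

section Sphere

variable [Fintype V]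

open Classical in
/-- The variable nodes reached from `e` by `k` non-backtracking steps, the step number `j` being
through a constraint node of type `T j`. -/
def sphere (ρ : S → V ≃ K × Fin n) (T : ℕ → S) : ℕ → V → Finset V
  | 0, e => {e}
  | k + 1, e => {f | ∃ g ∈ sphere ρ T k e, IsNeighbor ρ (T k) f g}

open Classical in
/-- The variable nodes reached from `e` by at most `k` steps. -/
def ball (ρ : S → V ≃ K × Fin n) (T : ℕ → S) (k : ℕ) (e : V) : Finset V :=
  (Finset.range (k + 1)).biUnion fun j => sphere ρ T j e

/-- Two nodes of the ball of radius `k`, the first of them on its boundary, that lie on the same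
constraint node of type `T k`. -/
def IsCollision (ρ : S → V ≃ K × Fin n) (T : ℕ → S) (k : ℕ) (e f g : V) : Prop :=
  f ∈ sphere ρ T k e ∧ g ∈ ball ρ T k e ∧ IsNeighbor ρ (T k) f g

/-- There is no collision at distance less than `k` from `e`. -/
def IsCollisionFree (ρ : S → V ≃ K × Fin n) (T : ℕ → S) (k : ℕ) (e : V) : Prop :=
  ∀ j < k, ∀ f g, ¬ IsCollision ρ T j e f g

theorem mem_sphere_zero : f ∈ sphere ρ T 0 e ↔ f = e := by simp [sphere]

theorem mem_sphere_succ {k : ℕ} :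
    f ∈ sphere ρ T (k + 1) e ↔ ∃ g ∈ sphere ρ T k e, IsNeighbor ρ (T k) f g := by simp [sphere]

theorem mem_ball {k : ℕ} : f ∈ ball ρ T k e ↔ ∃ j ≤ k, f ∈ sphere ρ T j e := by simp [ball]

theorem card_filter_fst_eq [DecidableEq K] (τ : V ≃ K × Fin n) (a : K) :
    (Finset.univ.filter fun x => (τ x).1 = a).card = n := by
  classical
  have himage : (Finset.univ.filter fun x => (τ x).1 = a) =
      Finset.univ.image fun i : Fin n => τ.symm (a, i) := by
    ext x
    simp only [Finset.mem_filter, Finset.mem_univ, true_and, Finset.mem_image, τ.symm_apply_eq]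
    exact ⟨fun h => ⟨(τ x).2, Prod.ext h.symm rfl⟩, fun ⟨i, hi⟩ => by rw [← hi]⟩
  rw [himage, Finset.card_image_of_injective _ fun i j hij => by simpa using hij, Finset.card_fin]

theorem card_sphere_le (k : ℕ) : (sphere ρ T k e).card ≤ n ^ k := by
  classical
  induction k with
  | zero => simp [sphere]
  | succ k ih =>
    have hsub : sphere ρ T (k + 1) e ⊆ (sphere ρ T k e).biUnion fun g =>
        Finset.univ.filter fun f => (ρ (T k) f).1 = (ρ (T k) g).1 := fun f hf => by
      obtain ⟨g, hg, -, hfg⟩ := mem_sphere_succ.1 hf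
      exact Finset.mem_biUnion.2 ⟨g, hg, by simpa using hfg⟩
    calc (sphere ρ T (k + 1) e).card
        ≤ (sphere ρ T k e).card * n := (Finset.card_le_card hsub).trans
          (Finset.card_biUnion_le_card_mul _ _ _ fun g _ =>
            (card_filter_fst_eq (ρ (T k)) _).le)
      _ ≤ n ^ (k + 1) := Nat.mul_le_mul_right _ ih

/-- Bound on the size of balls of radius `k`. -/
def ballBound (n k : ℕ) : ℕ := ∑ j ∈ Finset.range (k + 1), n ^ j

theorem card_ball_le (k : ℕ) : (ball ρ T k e).card ≤ ballBound n k := by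
  classical exact Finset.card_biUnion_le.trans (Finset.sum_le_sum fun j _ => card_sphere_le j)

theorem IsCollisionFree.mono {j k : ℕ} (h : IsCollisionFree ρ T k e) (hjk : j ≤ k) :
    IsCollisionFree ρ T j e :=
  fun i hi => h i (hi.trans_le hjk)

theorem IsCollisionFree.notMem_sphere {j k : ℕ} (h : IsCollisionFree ρ T k e) (hj : j < k)
    (hf : f ∈ sphere ρ T k e) : f ∉ sphere ρ T j e := fun hfj => by
  obtain ⟨k, rfl⟩ := Nat.exists_eq_add_one_of_ne_zero (Nat.ne_zero_of_lt hj)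
  obtain ⟨g, hg, hfg⟩ := mem_sphere_succ.1 hf
  exact h k k.lt_succ_self g f ⟨hg, mem_ball.2 ⟨j, Nat.lt_succ_iff.1 hj, hfj⟩, hfg.symm⟩

theorem fst_ne_of_notMem_sphere {k : ℕ} (hg : g ∈ sphere ρ T k e) (hf : f ∉ sphere ρ T k e)
    (hf' : f ∉ sphere ρ T (k + 1) e) : (ρ (T k) f).1 ≠ (ρ (T k) g).1 := fun h =>
  hf' (mem_sphere_succ.2 ⟨g, hg, fun hfg => hf (hfg ▸ hg), h⟩)

theorem exists_isCollision_of_not_isCollisionFree {h : ℕ} (hρ : ¬ IsCollisionFree ρ T h e) :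
    ∃ k < h, IsCollisionFree ρ T k e ∧ ∃ f g, IsCollision ρ T k e f g := by
  induction h with
  | zero => exact absurd (fun _ hk => absurd hk (Nat.not_lt_zero _)) hρ
  | succ h ih =>
    by_cases hfree : IsCollisionFree ρ T h e
    · by_contra! hno
      refine hρ fun k hk f g hfg => ?_
      rcases Nat.lt_succ_iff_lt_or_eq.1 hk with hk | rfl
      · exact hfree k hk f g hfg
      · exact hno k hk hfree f g hfg
    · obtain ⟨k, hk, hcoll⟩ := ih hfree
      exact ⟨k, hk.trans h.lt_succ_self, hcoll⟩

theorem IsNeighbor.mem_sphere {c : V} (hc : IsNeighbor ρ (T 0) c e) {k : ℕ}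
    (hf : f ∈ sphere ρ (fun j => T (j + 1)) k c) : f ∈ sphere ρ T (k + 1) e := by
  induction k generalizing f with
  | zero => exact mem_sphere_succ.2 ⟨e, mem_sphere_zero.2 rfl, mem_sphere_zero.1 hf ▸ hc⟩
  | succ k ih =>
    obtain ⟨g, hg, hfg⟩ := mem_sphere_succ.1 hf
    exact mem_sphere_succ.2 ⟨g, ih hg, hfg⟩

theorem IsCollisionFree.of_isNeighbor {c : V} {k : ℕ} (h : IsCollisionFree ρ T (k + 1) e)
    (hc : IsNeighbor ρ (T 0) c e) : IsCollisionFree ρ (fun j => T (j + 1)) k c := by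
  rintro j hj f g ⟨hf, hg, hfg⟩
  obtain ⟨i, hi, hgi⟩ := mem_ball.1 hg
  exact h (j + 1) (Nat.succ_lt_succ hj) f g
    ⟨hc.mem_sphere hf, mem_ball.2 ⟨i + 1, Nat.succ_le_succ hi, hc.mem_sphere hgi⟩, hfg⟩

theorem IsCollisionFree.disjoint_sphere {c c' : V} {k k' : ℕ}
    (h : IsCollisionFree ρ T (max k k' + 1) e) (hc : IsNeighbor ρ (T 0) c e)
    (hc' : IsNeighbor ρ (T 0) c' e) (hne : c ≠ c') :
    Disjoint (sphere ρ (fun j => T (j + 1)) k c) (sphere ρ (fun j => T (j + 1)) k' c') := by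
  refine Finset.disjoint_left.2 fun f hf hf' => ?_
  rcases lt_trichotomy k k' with hlt | rfl | hlt
  · exact (h.mono (by omega)).notMem_sphere (Nat.succ_lt_succ hlt) (hc'.mem_sphere hf')
      (hc.mem_sphere hf)
  · rw [max_self] at h
    induction k generalizing f with
    | zero => exact hne ((mem_sphere_zero.1 hf).symm.trans (mem_sphere_zero.1 hf'))
    | succ k ih =>
      obtain ⟨g, hg, hfg⟩ := mem_sphere_succ.1 hf
      obtain ⟨g', hg', hfg'⟩ := mem_sphere_succ.1 hf'
      have hgg' : g ≠ g' := fun hgg => ih g hg (h.mono k.succ.le_succ) (hgg ▸ hg')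
      exact h (k + 1) (Nat.lt_succ_self _) g g' ⟨hc.mem_sphere hg,
        mem_ball.2 ⟨k + 1, le_rfl, hc'.mem_sphere hg'⟩, hgg', hfg.2.symm.trans hfg'.2⟩
  · exact (h.mono (by omega)).notMem_sphere (Nat.succ_lt_succ hlt) (hc.mem_sphere hf)
      (hc'.mem_sphere hf')

end Sphere

/-- The decoding graph of `ρ` in which half-iteration `h + 1` processes the constraint nodes of type
`s h`. -/
def socketGraph (ρ : S → V ≃ K × Fin n) (s : ℕ → S) : DecodingGraph n V where
  nbr h v i := (ρ (s h)).symm ((ρ (s h) v).1, i)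
  pos h v := (ρ (s h) v).2

/-- The types of the constraint nodes met on the way down from a message of half-iteration `h`. Only
the values for `k < h` are meaningful. -/
def stepType (s : ℕ → S) (h k : ℕ) : S := s (h - 1 - k)

theorem stepType_succ (s : ℕ → S) (h : ℕ) :
    (fun j => stepType s (h + 1) (j + 1)) = stepType s h := by
  funext j
  rw [stepType, stepType, Nat.add_sub_cancel, Nat.sub_sub, add_comm]

theorem isNeighbor_nbr {s : ℕ → S} {h : ℕ} {v : V} {i : Fin n}
    (hi : i ≠ (socketGraph ρ s).pos h v) :
    IsNeighbor ρ (stepType s (h + 1) 0) ((socketGraph ρ s).nbr h v i) v := by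
  have hsocket : ρ (s h) ((socketGraph ρ s).nbr h v i) = ((ρ (s h) v).1, i) :=
    Equiv.apply_symm_apply _ _
  refine ⟨fun hv => hi ?_, (Prod.ext_iff.1 hsocket).1⟩
  rw [hv] at hsocket
  exact (congrArg Prod.snd hsocket).symm

theorem socketGraph_nbr_injective (s : ℕ → S) (h : ℕ) (v : V) :
    Function.Injective ((socketGraph ρ s).nbr h v) := fun _ _ hij =>
  congrArg Prod.snd ((ρ (s h)).symm.injective hij)

variable [Fintype V]

theorem exists_mem_sphere_of_mem_support {s : ℕ → S} {h : ℕ}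
    (hf : f ∈ (socketGraph ρ s).support h e) : ∃ k ≤ h, f ∈ sphere ρ (stepType s h) k e := by
  induction h generalizing e with
  | zero => exact ⟨0, le_rfl, mem_sphere_zero.2 (Finset.mem_singleton.1 hf)⟩
  | succ h ih =>
    simp only [DecodingGraph.support, Finset.mem_insert, Finset.mem_biUnion] at hf
    rcases hf with rfl | ⟨i, hi, hf⟩
    · exact ⟨0, Nat.zero_le _, mem_sphere_zero.2 rfl⟩
    · obtain ⟨k, hk, hfk⟩ := ih hf
      rw [← stepType_succ] at hfk
      exact ⟨k + 1, Nat.succ_le_succ hk,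
        (isNeighbor_nbr (Finset.ne_of_mem_erase hi)).mem_sphere hfk⟩

theorem IsCollisionFree.isTreeLike {s : ℕ → S} {h : ℕ}
    (hfree : IsCollisionFree ρ (stepType s h) h e) : (socketGraph ρ s).IsTreeLike h e := by
  induction h generalizing e with
  | zero => trivial
  | succ h ih =>
    refine ⟨fun i hi => ⟨ih ?_, fun he => ?_⟩, fun i hi j hj hij => ?_⟩
    · rw [← stepType_succ]
      exact hfree.of_isNeighbor (isNeighbor_nbr hi)
    · obtain ⟨k, hk, hek⟩ := exists_mem_sphere_of_mem_support he
      rw [← stepType_succ] at hek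
      exact (hfree.mono (Nat.succ_le_succ hk)).notMem_sphere k.succ_pos
        ((isNeighbor_nbr hi).mem_sphere hek) (mem_sphere_zero.2 rfl)
    · refine Finset.disjoint_left.2 fun f hf hf' => ?_
      obtain ⟨k, hk, hfk⟩ := exists_mem_sphere_of_mem_support hf
      obtain ⟨k', hk', hfk'⟩ := exists_mem_sphere_of_mem_support hf'
      rw [← stepType_succ] at hfk hfk'
      exact Finset.disjoint_left.1 ((hfree.mono (by omega)).disjoint_sphere (isNeighbor_nbr hi)
        (isNeighbor_nbr hj) ((socketGraph_nbr_injective s h e).ne hij)) hfk hfk'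

end Sockets

section Switching

variable {V K S : Type*} [DecidableEq V] [DecidableEq S]

/-- Interchanges the sockets of type `s` of the variable nodes `f` and `x`. -/
def switch (ρ : S → V ≃ K × Fin n) (s : S) (f x : V) : S → V ≃ K × Fin n :=
  Function.update ρ s ((Equiv.swap f x).trans (ρ s))

variable {ρ : S → V ≃ K × Fin n} {T : ℕ → S} {e f g x : V} {k : ℕ}

theorem switch_apply (s : S) (y : V) : switch ρ s f x s y = ρ s (Equiv.swap f x y) := by
  simp [switch]

theorem switch_of_ne {s s' : S} (h : s' ≠ s) : switch ρ s f x s' = ρ s' := by simp [switch, h]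

theorem switch_switch (s : S) : switch (switch ρ s f x) s f x = ρ := by
  funext s'
  ext1 y
  by_cases hs : s' = s
  · rw [hs, switch_apply, switch_apply, Equiv.swap_apply_self]
  · rw [switch_of_ne hs, switch_of_ne hs]

theorem switch_injective (s : S) : Function.Injective (switch ρ s f) := fun x x' hx => by
  have hf : ∀ x, switch ρ s f x s f = ρ s x := fun x => by
    rw [switch_apply, Equiv.swap_apply_left]
  exact (ρ s).injective (by rw [← hf, ← hf, hx])

theorem isNeighbor_switch_iff {s : S} (hf : (ρ s f).1 ≠ (ρ s g).1) (hx : (ρ s x).1 ≠ (ρ s g).1)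
    (y : V) : IsNeighbor (switch ρ s f x) s y g ↔ IsNeighbor ρ s y g := by
  have hgf : g ≠ f := fun h => hf (by rw [h])
  have hgx : g ≠ x := fun h => hx (by rw [h])
  rw [IsNeighbor, IsNeighbor, switch_apply, switch_apply, Equiv.swap_apply_of_ne_of_ne hgf hgx]
  refine and_congr_right fun _ => ?_
  by_cases hyf : y = f
  · rw [hyf, Equiv.swap_apply_left]
    exact iff_of_false hx hf
  by_cases hyx : y = x
  · rw [hyx, Equiv.swap_apply_right]
    exact iff_of_false hf hx
  rw [Equiv.swap_apply_of_ne_of_ne hyf hyx]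

variable [Fintype V]

theorem sphere_switch (hT : ∀ j < k, T (j + 1) ≠ T j) (hfree : IsCollisionFree ρ T k e)
    (hf : f ∈ sphere ρ T k e) (hx : x ∉ ball ρ T k e) {j : ℕ} (hj : j ≤ k) :
    sphere (switch ρ (T k) f x) T j e = sphere ρ T j e := by
  induction j with
  | zero => rfl
  | succ j ih =>
    ext y
    rw [mem_sphere_succ, mem_sphere_succ, ih (Nat.le_of_succ_le hj)]
    refine exists_congr fun g => and_congr_right fun hg => ?_
    by_cases hTj : T j = T k
    · have hjk : j + 1 < k := hj.lt_of_ne fun h => hT j hj (h ▸ hTj.symm)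
      have hx' : ∀ i ≤ k, x ∉ sphere ρ T i e := fun i hi h => hx (mem_ball.2 ⟨i, hi, h⟩)
      rw [← hTj]
      exact isNeighbor_switch_iff
        (fst_ne_of_notMem_sphere hg (hfree.notMem_sphere hj hf) (hfree.notMem_sphere hjk hf))
        (fst_ne_of_notMem_sphere hg (hx' j (Nat.le_of_succ_le hj)) (hx' (j + 1) hj)) y
    · rw [IsNeighbor, IsNeighbor, switch_of_ne hTj]

theorem ball_switch (hT : ∀ j < k, T (j + 1) ≠ T j) (hfree : IsCollisionFree ρ T k e)
    (hf : f ∈ sphere ρ T k e) (hx : x ∉ ball ρ T k e) :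
    ball (switch ρ (T k) f x) T k e = ball ρ T k e := by
  ext y
  simp only [mem_ball]
  exact exists_congr fun j => and_congr_right fun hj => by rw [sphere_switch hT hfree hf hx hj]

theorem IsCollision.fst_switch_eq (h : IsCollision ρ T k e f g) (hx : x ∉ ball ρ T k e) :
    (switch ρ (T k) f x (T k) x).1 = (switch ρ (T k) f x (T k) g).1 := by
  have hgx : g ≠ x := fun hgx => hx (hgx ▸ h.2.1)
  rw [switch_apply, switch_apply, Equiv.swap_apply_right,
    Equiv.swap_apply_of_ne_of_ne h.2.2.1.symm hgx, h.2.2.2]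

variable [Fintype K] [DecidableEq K] [Fintype S]

open Classical in
/-- The graphs in which the first collision near `e` occurs at distance `k`, together with two nodes
that collide there. -/
def collisions (T : ℕ → S) (k : ℕ) (e : V) : Finset (Σ _ : S → V ≃ K × Fin n, V × V) :=
  {q | IsCollisionFree q.1 T k e ∧ IsCollision q.1 T k e q.2.1 q.2.2}

theorem mem_collisions {q : Σ _ : S → V ≃ K × Fin n, V × V} :
    q ∈ collisions T k e ↔ IsCollisionFree q.1 T k e ∧ IsCollision q.1 T k e q.2.1 q.2.2 := by
  simp [collisions]

open Classical in
/- Double counting: at a collision `(f, g)`, the socket of `f` may be switched with that of any `x`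
outside the ball without changing the ball, and `x` can be recovered up to `n` choices, since it now
shares the constraint node of `g`. -/
theorem card_collisions_mul_le (hT : ∀ j < k, T (j + 1) ≠ T j) (e : V) :
    (collisions T k e : Finset (Σ _ : S → V ≃ K × Fin n, V × V)).card *
        (Fintype.card V - ballBound n k) ≤
      Fintype.card (S → V ≃ K × Fin n) * (ballBound n k * ballBound n k) * n := by
  let pairs : Finset (Σ _ : S → V ≃ K × Fin n, V × V) :=
    Finset.univ.sigma fun ρ => ball ρ T k e ×ˢ ball ρ T k e
  have hpairs : pairs.card ≤
      Fintype.card (S → V ≃ K × Fin n) * (ballBound n k * ballBound n k) := by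
    rw [Finset.card_sigma, ← smul_eq_mul, ← Finset.card_univ]
    exact Finset.sum_le_card_nsmul _ _ _ fun ρ _ => (Finset.card_product _ _).trans_le
      (Nat.mul_le_mul (card_ball_le k) (card_ball_le k))
  refine (Finset.card_mul_le_card_mul (t := pairs)
    (fun p q => ∃ x ∉ ball p.1 T k e, q = ⟨switch p.1 (T k) p.2.1 x, p.2⟩)
    (fun p hp => ?_) (fun q _ => ?_)).trans (Nat.mul_le_mul_right n hpairs)
  · obtain ⟨hfree, hcoll⟩ := mem_collisions.1 hp
    calc Fintype.card V - ballBound n k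
        ≤ ((ball p.1 T k e)ᶜ).card := by
          rw [Finset.card_compl]
          exact Nat.sub_le_sub_left (card_ball_le k) _
      _ ≤ _ := Finset.card_le_card_of_injOn (fun x => ⟨switch p.1 (T k) p.2.1 x, p.2⟩)
          (fun x hx => ?_) fun x _ x' _ hxx' => switch_injective _ (congrArg Sigma.fst hxx')
    rw [Finset.mem_coe, Finset.mem_compl] at hx
    refine Finset.mem_coe.2 ((Finset.mem_bipartiteAbove _).2
      ⟨Finset.mem_sigma.2 ⟨Finset.mem_univ _, ?_⟩, x, hx, rfl⟩)
    rw [ball_switch hT hfree hcoll.1 hx]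
    exact Finset.mem_product.2 ⟨mem_ball.2 ⟨k, le_rfl, hcoll.1⟩, hcoll.2.1⟩
  · refine ((Finset.card_le_card fun p hp => ?_).trans (Finset.card_image_le
      (f := fun x => (⟨switch q.1 (T k) q.2.1 x, q.2⟩ : Σ _ : S → V ≃ K × Fin n, V × V)))).trans
      (card_filter_fst_eq (q.1 (T k)) (q.1 (T k) q.2.2).1).le
    obtain ⟨hcoll, x, hx, rfl⟩ := (Finset.mem_bipartiteBelow _).1 hp
    refine Finset.mem_image.2 ⟨x, ?_, by simp only [switch_switch]⟩
    simpa using (mem_collisions.1 hcoll).2.fst_switch_eq hx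

open Classical in
theorem card_not_isCollisionFree_le (h : ℕ) (e : V) :
    (Finset.univ.filter fun ρ : S → V ≃ K × Fin n => ¬ IsCollisionFree ρ T h e).card ≤
      ∑ k ∈ Finset.range h,
        (collisions T k e : Finset (Σ _ : S → V ≃ K × Fin n, V × V)).card := by
  refine (Finset.card_le_card (t := (Finset.range h).biUnion fun k =>
    (collisions T k e).image Sigma.fst) fun ρ hρ => ?_).trans
      (Finset.card_biUnion_le.trans (Finset.sum_le_sum fun k _ => Finset.card_image_le))
  obtain ⟨k, hk, hfree, f, g, hcoll⟩ :=
    exists_isCollision_of_not_isCollisionFree (Finset.mem_filter.1 hρ).2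
  exact Finset.mem_biUnion.2 ⟨k, Finset.mem_range.2 hk,
    Finset.mem_image.2 ⟨⟨ρ, f, g⟩, mem_collisions.2 ⟨hfree, hcoll⟩, rfl⟩⟩

/-- Bound on the probability of a collision at distance less than `h` from a given node in a random
graph with `N` variable nodes. -/
def cycleBound (n h N : ℕ) : ℝ :=
  ∑ k ∈ Finset.range h, (ballBound n k * ballBound n k * n : ℝ) / (N - ballBound n k)

theorem tendsto_cycleBound (n h : ℕ) : Tendsto (cycleBound n h) atTop (𝓝 0) := by
  rw [← Finset.sum_const_zero (s := Finset.range h)]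
  exact tendsto_finsetSum _ fun k _ => tendsto_const_nhds.div_atTop
    (tendsto_atTop_add_const_right _ _ tendsto_natCast_atTop_atTop)

open Classical in
theorem card_not_isCollisionFree_le_cycleBound_mul {h : ℕ} (hT : ∀ j, j + 1 < h → T (j + 1) ≠ T j)
    (hV : ∀ k < h, ballBound n k < Fintype.card V) (e : V) :
    ((Finset.univ.filter fun ρ : S → V ≃ K × Fin n => ¬ IsCollisionFree ρ T h e).card : ℝ) ≤
      cycleBound n h (Fintype.card V) * Fintype.card (S → V ≃ K × Fin n) := by
  refine (Nat.cast_le.2 (card_not_isCollisionFree_le h e)).trans ?_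
  rw [cycleBound, Finset.sum_mul, Nat.cast_sum]
  refine Finset.sum_le_sum fun k hk => ?_
  have hk : k < h := Finset.mem_range.1 hk
  have hcard : (((collisions T k e : Finset (Σ _ : S → V ≃ K × Fin n, V × V)).card *
      (Fintype.card V - ballBound n k) : ℕ) : ℝ) ≤ _ :=
    Nat.cast_le.2 (card_collisions_mul_le (fun j hj => hT j (by omega)) e)
  push_cast [Nat.cast_sub (hV k hk).le] at hcard
  rw [div_mul_eq_mul_div, le_div_iff₀ (sub_pos.2 (Nat.cast_lt.2 (hV k hk)))]
  linarith

end Switching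

section Relabelling

variable {V K S : Type*} [Fintype V] {ρ : S → V ≃ K × Fin n} {T : ℕ → S} {e f g : V}

theorem mem_sphere_trans_iff (τ : V ≃ V) {k : ℕ} :
    f ∈ sphere (fun s => τ.trans (ρ s)) T k e ↔ τ f ∈ sphere ρ T k (τ e) := by
  induction k generalizing f with
  | zero => rw [mem_sphere_zero, mem_sphere_zero, τ.apply_eq_iff_eq]
  | succ k ih =>
    rw [mem_sphere_succ, mem_sphere_succ]
    exact τ.exists_congr fun g => and_congr ih (and_congr τ.injective.ne_iff.symm Iff.rfl)

theorem isCollision_trans_iff (τ : V ≃ V) {k : ℕ} :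
    IsCollision (fun s => τ.trans (ρ s)) T k e f g ↔ IsCollision ρ T k (τ e) (τ f) (τ g) := by
  simp only [IsCollision, mem_ball, mem_sphere_trans_iff, IsNeighbor, τ.injective.ne_iff,
    Equiv.trans_apply]

theorem isCollisionFree_trans_iff (τ : V ≃ V) {k : ℕ} :
    IsCollisionFree (fun s => τ.trans (ρ s)) T k e ↔ IsCollisionFree ρ T k (τ e) :=
  forall₂_congr fun _ _ => τ.forall_congr fun _ => τ.forall_congr fun _ =>
    not_congr (isCollision_trans_iff τ)

end Relabelling

/-! ### The ensemble -/

section EdgePerms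

variable {K : Type*}

/-- The graph of the edge permutation `π`, with rows as the constraint nodes of type `false` and
columns as those of type `true`. -/
def edgePerms (π : Equiv.Perm (K × Fin n)) (s : Bool) : K × Fin n ≃ K × Fin n :=
  if s then π else 1

variable [Fintype K] [DecidableEq K] {T : ℕ → Bool} {h : ℕ}

open Classical in
-- Relabelling the variable nodes by `τ` turns `(edgePerms π, e)` into an arbitrary pair of
-- permutations with the root `τ⁻¹ e`, and collision-freeness is invariant.
theorem card_not_isCollisionFree_edgePerms_mul_le :
    (Finset.univ.filter fun q : Equiv.Perm (K × Fin n) × K × Fin n =>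
      ¬ IsCollisionFree (edgePerms q.1) T h q.2).card * Fintype.card (Equiv.Perm (K × Fin n)) ≤
    ∑ e, (Finset.univ.filter fun ρ : Bool → K × Fin n ≃ K × Fin n =>
      ¬ IsCollisionFree ρ T h e).card := by
  rw [← Finset.card_univ, ← Finset.card_product, ← Finset.card_sigma]
  refine Finset.card_le_card_of_injOn
    (fun q => ⟨q.2.symm q.1.2, fun s => q.2.trans (edgePerms q.1.1 s)⟩) (fun q hq => ?_) ?_
  · simpa [isCollisionFree_trans_iff] using hq
  · rintro ⟨⟨π, e⟩, τ⟩ - ⟨⟨π', e'⟩, τ'⟩ - hq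
    obtain ⟨he, hρ⟩ := Sigma.mk.inj hq
    have hρ : ∀ s, τ.trans (edgePerms π s) = τ'.trans (edgePerms π' s) := congrFun (eq_of_heq hρ)
    have hτ : τ = τ' := hρ false
    subst hτ
    have hπ : π = π' := Equiv.ext fun x => by
      simpa [edgePerms] using DFunLike.congr_fun (hρ true) (τ.symm x)
    have he' : e = e' := τ.symm.injective he
    rw [hπ, he']

open Classical in
theorem card_not_isCollisionFree_edgePerms_le (hT : ∀ j, j + 1 < h → T (j + 1) ≠ T j)
    (hK : ∀ k < h, ballBound n k < Fintype.card (K × Fin n)) :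
    ((Finset.univ.filter fun q : Equiv.Perm (K × Fin n) × K × Fin n =>
      ¬ IsCollisionFree (edgePerms q.1) T h q.2).card : ℝ) ≤
    cycleBound n h (Fintype.card (K × Fin n)) *
      Fintype.card (Equiv.Perm (K × Fin n) × K × Fin n) := by
  have hperm : (0 : ℝ) < Fintype.card (Equiv.Perm (K × Fin n)) := Nat.cast_pos.2 Fintype.card_pos
  refine le_of_mul_le_mul_right ?_ hperm
  calc _ ≤ ∑ e, ((Finset.univ.filter fun ρ : Bool → K × Fin n ≃ K × Fin n =>
        ¬ IsCollisionFree ρ T h e).card : ℝ) :=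
        mod_cast card_not_isCollisionFree_edgePerms_mul_le (n := n) (K := K) (T := T) (h := h)
    _ ≤ ∑ _e : K × Fin n, cycleBound n h (Fintype.card (K × Fin n)) *
        Fintype.card (Bool → K × Fin n ≃ K × Fin n) :=
        Finset.sum_le_sum fun e _ => card_not_isCollisionFree_le_cycleBound_mul hT hK e
    _ = _ := by
        rw [Finset.sum_const, Finset.card_univ, nsmul_eq_mul, Fintype.card_fun, Fintype.card_bool,
          Fintype.card_prod (Equiv.Perm (K × Fin n))]
        push_cast
        ring

end EdgePerms

section Ensemble

variable {M : ℕ} {C : LinCode n} {π : Equiv.Perm (Fin M × Fin n)}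

/-- The graph of the edge permutation `π` with the schedule of the decoder, in which rows and
columns alternate. -/
def ensGraph (π : Equiv.Perm (Fin M × Fin n)) : DecodingGraph n (Fin M × Fin n) :=
  socketGraph (edgePerms π) Nat.bodd

theorem ensMsg_eq_msg (t : ℕ) (μ : ℕ → Lut) (l : Fin M × Fin n → ℝ) (h : ℕ) (e : Fin M × Fin n) :
    ensMsg C t π μ l h e = (ensGraph π).msg C t μ l h e := by
  induction h generalizing e with
  | zero => rfl
  | succ h ih =>
    rw [ensMsg, DecodingGraph.msg]
    simp only [ih, ensGraph, socketGraph]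
    cases hh : Nat.bodd h
    · rw [if_pos (by rw [Nat.even_iff, Nat.mod_two_of_bodd, hh]; rfl)]
      rfl
    · rw [if_neg (by rw [Nat.even_iff, Nat.mod_two_of_bodd, hh]; decide)]
      rfl

theorem isCodeword_ensGraph {w : Fin M × Fin n → ZMod 2} (hw : w ∈ gldpcCode C π) :
    (ensGraph π).IsCodeword C w := fun h v => by
  have hown : (ensGraph π).nbr h v ((ensGraph π).pos h v) = v := Equiv.symm_apply_apply _ _
  have hword : (fun i => if i = (ensGraph π).pos h v then w v else w ((ensGraph π).nbr h v i)) =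
      fun i => w ((ensGraph π).nbr h v i) := by
    funext i
    split_ifs with hi
    · rw [hi, hown]
    · rfl
  rw [hword]
  change (fun i => w ((edgePerms π h.bodd).symm ((edgePerms π h.bodd v).1, i))) ∈ C
  cases Nat.bodd h
  · exact hw.1 v.1
  · exact hw.2 (π v).1

theorem stepType_bodd_ne {h j : ℕ} (hj : j + 1 < h) :
    stepType Nat.bodd h (j + 1) ≠ stepType Nat.bodd h j := by
  have hstep : h - 1 - j = h - 1 - (j + 1) + 1 := by omega
  rw [stepType, stepType, hstep, Nat.bodd_succ]
  exact Bool.self_ne_not _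

theorem abs_sum_div_card_sub_le {ι : Type*} [Fintype ι] [Nonempty ι] {q : ι → ℝ} {x B : ℝ}
    (s : Finset ι) (heq : ∀ i ∉ s, q i = x) (hle : ∀ i, |q i - x| ≤ B) :
    |(∑ i, q i) / Fintype.card ι - x| ≤ s.card / Fintype.card ι * B := by
  have hcard : (0 : ℝ) < Fintype.card ι := Nat.cast_pos.2 Fintype.card_pos
  have hdiff : (∑ i, q i) / Fintype.card ι - x = (∑ i ∈ s, (q i - x)) / Fintype.card ι := by
    rw [Finset.sum_subset s.subset_univ fun i _ hi => sub_eq_zero.2 (heq i hi),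
      Finset.sum_sub_distrib, Finset.sum_const, Finset.card_univ, nsmul_eq_mul, sub_div,
      mul_div_cancel_left₀ _ hcard.ne']
  rw [hdiff, abs_div, abs_of_pos hcard, div_mul_eq_mul_div]
  gcongr
  calc |∑ i ∈ s, (q i - x)| ≤ ∑ i ∈ s, |q i - x| := Finset.abs_sum_le_sum_abs _ _
    _ ≤ s.card * B := by
      rw [← nsmul_eq_mul]
      exact Finset.sum_le_card_nsmul _ _ _ fun i _ => hle i

theorem abs_ensErr_sub_deSeq_le {t : ℕ} (hC : CorrectsErrors C t) (hCt : HasTransitiveAut C) {σ : ℝ}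
    (hσ : 0 < σ) {μ : ℕ → Lut} {h : ℕ} (hμ : ∀ k < h, OddLut (μ (k + 1)))
    {w : Equiv.Perm (Fin M × Fin n) → Fin M × Fin n → ZMod 2} (hw : ∀ π, w π ∈ gldpcCode C π)
    [Nonempty (Fin M × Fin n)] (hM : ∀ k < h, ballBound n k < M * n) :
    |ensErr C t σ μ M w h - deSeq C t σ μ h| ≤
      cycleBound n h (M * n) * (1 + |deSeq C t σ μ h|) := by
  classical
  let err (q : Equiv.Perm (Fin M × Fin n) × Fin M × Fin n) : ℝ :=
    (Measure.pi fun _ : Fin M × Fin n => noiseLaw σ).real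
      {z | ensMsg C t q.1 μ (channelLlr σ (w q.1) z) h q.2 ≠ w q.1 q.2}
  let bad : Finset (Equiv.Perm (Fin M × Fin n) × Fin M × Fin n) :=
    {q | ¬ IsCollisionFree (edgePerms q.1) (stepType Nat.bodd h) h q.2}
  have hens : ensErr C t σ μ M w h =
      (∑ q, err q) / Fintype.card (Equiv.Perm (Fin M × Fin n) × Fin M × Fin n) := by
    rw [ensErr, Fintype.sum_prod_type, Fintype.card_prod (Equiv.Perm (Fin M × Fin n)), Nat.cast_mul]
    rfl
  have hgood : ∀ q ∉ bad, err q = deSeq C t σ μ h := fun q hq => by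
    have hfree : IsCollisionFree (edgePerms q.1) (stepType Nat.bodd h) h q.2 := by
      simpa [bad] using hq
    simp only [err, ensMsg_eq_msg]
    exact hfree.isTreeLike.measureReal_msg_ne hC hCt hσ (isCodeword_ensGraph (hw q.1))
      (isAWGN_eval_pi σ) hμ
  have herr : ∀ q, |err q - deSeq C t σ μ h| ≤ 1 + |deSeq C t σ μ h| := fun q =>
    (abs_sub _ _).trans (add_le_add_left ((abs_of_nonneg measureReal_nonneg).trans_le
      measureReal_le_one) _)
  have hbad : (bad.card : ℝ) / Fintype.card (Equiv.Perm (Fin M × Fin n) × Fin M × Fin n) ≤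
      cycleBound n h (M * n) := by
    rw [div_le_iff₀ (Nat.cast_pos.2 Fintype.card_pos)]
    simpa using card_not_isCollisionFree_edgePerms_le (K := Fin M) (n := n) (h := h)
      (fun j => stepType_bodd_ne) (by simpa using hM)
  rw [hens]
  exact (abs_sum_div_card_sub_le bad hgood herr).trans
    (mul_le_mul_of_nonneg_right hbad (by positivity))

theorem tendsto_ensErr {t : ℕ} (hn : 0 < n) (hC : CorrectsErrors C t) (hCt : HasTransitiveAut C)
    {σ : ℝ} (hσ : 0 < σ) {μ : ℕ → Lut} {h : ℕ} (hμ : ∀ k < h, OddLut (μ (k + 1)))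
    {w : (M : ℕ) → Equiv.Perm (Fin M × Fin n) → Fin M × Fin n → ZMod 2}
    (hw : ∀ M π, w M π ∈ gldpcCode C π) :
    Tendsto (fun M => ensErr C t σ μ M (w M) h) atTop (𝓝 (deSeq C t σ μ h)) := by
  have hsize : Tendsto (· * n) atTop atTop := tendsto_id.atTop_mul_const' hn
  have hbound : Tendsto (fun M => cycleBound n h (M * n) * (1 + |deSeq C t σ μ h|)) atTop
      (𝓝 0) := by
    simpa using ((tendsto_cycleBound n h).comp hsize).mul_const (1 + |deSeq C t σ μ h|)
  refine tendsto_iff_norm_sub_tendsto_zero.2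
    (squeeze_zero' (Eventually.of_forall fun _ => norm_nonneg _) ?_ hbound)
  have hlarge : ∀ᶠ M in atTop, ∀ k < h, ballBound n k < M * n :=
    (Set.finite_lt_nat h).eventually_all.2 fun k _ => hsize.eventually_gt_atTop _
  filter_upwards [hlarge, eventually_gt_atTop 0] with M hM hM0
  have : Nonempty (Fin M × Fin n) := ⟨⟨0, hM0⟩, ⟨0, hn⟩⟩
  exact abs_ensErr_sub_deSeq_le hC hCt hσ hμ (hw M) hM

end Ensemble

end

end IBDDCR

theorem proposition1 {n : ℕ} (C : LinCode n) (t : ℕ) (hC : CorrectsErrors C t)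
    (hCt : HasTransitiveAut C) (σ : ℝ) (hσ : 0 < σ)
    {Ω : Type*} [MeasurableSpace Ω] (P : Measure Ω) [IsProbabilityMeasure P]
    (pos : List (Fin n) → Fin n)
    -- the transmitted random codeword on the computation tree; both root bits have positive probability
    (c : Ω → List (Fin n) → ZMod 2) (hc : Measurable c)
    (hcode : ∀ ω, IsTreeCodeword C pos (c ω)) (hbit : ∀ b, P {ω | c ω [] = b} ≠ 0)
    -- the noise: independent, centred Gaussian of variance `σ²`, independent of the codeword
    (z : Ω → List (Fin n) → ℝ) (hz : Measurable z)
    (hlaw : ∀ v, HasLaw (fun ω => z ω v) (gaussianReal 0 (σ ^ 2).toNNReal) P)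
    (hindep : iIndepFun (fun v ω => z ω v) P) (hcz : IndepFun c z P) :
    let μ := muTilde P C t σ pos c z
    let xr := rowErr P C t σ pos c z
    let xc := colErr P C t σ pos c z
    -- the correction terms for row decoding in iteration `ℓ`
    (∀ ℓ ≥ 1, μ (2 * ℓ - 1) (-1) (-1) = Real.log (fPe C t (xc (ℓ - 1)) / fQc C t (xc (ℓ - 1))) ∧
      μ (2 * ℓ - 1) 1 (-1) = Real.log (fPc C t (xc (ℓ - 1)) / fQe C t (xc (ℓ - 1))) ∧
      μ (2 * ℓ - 1) 0 (-1) = Real.log (fPz C t (xc (ℓ - 1)) / fQz C t (xc (ℓ - 1))) ∧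
      μ (2 * ℓ - 1) (-1) 1 = Real.log (fQe C t (xc (ℓ - 1)) / fPc C t (xc (ℓ - 1))) ∧
      μ (2 * ℓ - 1) 1 1 = Real.log (fQc C t (xc (ℓ - 1)) / fPe C t (xc (ℓ - 1))) ∧
      μ (2 * ℓ - 1) 0 1 = Real.log (fQz C t (xc (ℓ - 1)) / fPz C t (xc (ℓ - 1)))) ∧
    -- the correction terms for column decoding in iteration `ℓ`
    (∀ ℓ ≥ 1, μ (2 * ℓ) (-1) (-1) = Real.log (fPe C t (xr ℓ) / fQc C t (xr ℓ)) ∧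
      μ (2 * ℓ) 1 (-1) = Real.log (fPc C t (xr ℓ) / fQe C t (xr ℓ)) ∧
      μ (2 * ℓ) 0 (-1) = Real.log (fPz C t (xr ℓ) / fQz C t (xr ℓ)) ∧
      μ (2 * ℓ) (-1) 1 = Real.log (fQe C t (xr ℓ) / fPc C t (xr ℓ)) ∧
      μ (2 * ℓ) 1 1 = Real.log (fQc C t (xr ℓ) / fPe C t (xr ℓ)) ∧
      μ (2 * ℓ) 0 1 = Real.log (fQz C t (xr ℓ) / fPz C t (xr ℓ))) ∧
    -- the conditional probabilities behind them: at input message error probability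
    -- `x = msgErr h`, for the BDD output of half-iteration `h + 1`
    (∀ h, let x := msgErr P C t σ pos c z h
      let p := condBdd P C t σ pos c z μ h
      (p (-1) (-1) 0 = fPe C t x ∧ p 1 (-1) 0 = fPc C t x ∧ p 0 (-1) 0 = fPz C t x ∧
        p (-1) 1 0 = fQe C t x ∧ p 1 1 0 = fQc C t x ∧ p 0 1 0 = fQz C t x) ∧
      (p 1 1 1 = fPe C t x ∧ p (-1) 1 1 = fPc C t x ∧ p 0 1 1 = fPz C t x ∧
        p 1 (-1) 1 = fQe C t x ∧ p (-1) (-1) 1 = fQc C t x ∧ p 0 (-1) 1 = fQz C t x)) ∧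
    (∀ i < n, Pz C t i = 1 - Pe C t i - Pc C t i ∧ Qz C t i = 1 - Qe C t i - Qc C t i) ∧
    -- the density evolution recursions
    xc 0 = gaussQ (1 / σ) ∧
    (∀ ℓ ≥ 1, xr ℓ = deStep C t σ (xc (ℓ - 1)) ∧ xc ℓ = deStep C t σ (xr ℓ)) ∧
    -- they give the limiting message error probabilities of iBDD-CR on the GLDPC ensemble
    (∀ w : (M : ℕ) → Equiv.Perm (Fin M × Fin n) → Fin M × Fin n → ZMod 2,
      (∀ M π, w M π ∈ gldpcCode C π) → ∀ ℓ ≥ 1,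
        Tendsto (fun M => ensErr C t σ μ M (w M) (2 * ℓ - 1)) atTop (𝓝 (xr ℓ)) ∧
        Tendsto (fun M => ensErr C t σ μ M (w M) (2 * ℓ)) atTop (𝓝 (xc ℓ))) := by
  intro μ xr xc
  have hpc : IsTreeTransmission C pos σ P c z :=
    { measurable := hc
      isTreeCodeword := hcode
      measure_root_ne_zero := hbit
      isAWGN := ⟨fun v => (measurable_pi_apply v).comp hz, hindep, fun v => (hlaw v).map_eq⟩
      indepFun := hcz }
  have hlut := hpc.isLogRatioLut_msgErr hC hCt hσ
  have hstep := hpc.msgErr_succ hC hCt hσ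
  have hcond := hpc.condBdd_muTilde_eq_mix_msgErr hC hCt hσ
  have hlim := fun w hw h => hpc.msgErr_muTilde_eq_deSeq hC hCt hσ h ▸
    tendsto_ensErr (h := h) (w := w) (pos []).pos hC hCt hσ
      (fun k _ => hpc.oddLut_muTilde_succ hC hCt hσ k) hw
  refine ⟨?_, ?_, fun h => ⟨?_, ?_⟩, fun i hi => ⟨?_, ?_⟩, ?_, ?_, ?_⟩
  · rintro (_ | ℓ) hℓ
    exacts [absurd hℓ (by simp), (hlut (2 * ℓ)).table]
  · rintro (_ | ℓ) hℓ
    exacts [absurd hℓ (by simp), (hlut (2 * ℓ + 1)).table]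
  · exact ⟨hcond h (-1) 1 0, hcond h 1 1 0, hcond h 0 1 0, hcond h (-1) 0 0, hcond h 1 0 0,
      hcond h 0 0 0⟩
  · exact ⟨hcond h 1 0 1, hcond h (-1) 0 1, hcond h 0 0 1, hcond h 1 1 1, hcond h (-1) 1 1,
      hcond h 0 1 1⟩
  · exact outcomeProb_zero C t 1 hi
  · exact outcomeProb_zero C t 0 hi
  · exact hpc.msgErr_muTilde_eq_deSeq hC hCt hσ 0
  · rintro (_ | ℓ) hℓ
    exacts [absurd hℓ (by simp), ⟨hstep (2 * ℓ), hstep (2 * ℓ + 1)⟩]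
  · exact fun w hw ℓ _ => ⟨hlim w hw _, hlim w hw _⟩
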